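/- **Conventions.** A finite presentation $\langle x_1,\dots,x_n\mid r_1,\dots,r_m\rangle$ is taken up to renaming generators and reordering relators. Two finite presentations are *$Q^{**}$-equivalent* ($\sim_{Q^{**}}$) if they are related by a finite sequence of the following operations and their inverses: (1) replace a relator $r_i$ by $r_i^{-1}$; (2) replace $r_i$ by $r_ir_j$ for some $j\ne i$; (3) replace $r_i$ by $wr_iw^{-1}$ for some $w\in F(x_1,\dots,x_n)$; (4) add a generator $x_{n+1}$ and a relator equal to $x_{n+1}$; (5) replace every relator $r_i$ by $\phi(r_i)$, for an automorphism $\phi$ of $F(x_1,\dots,x_n)$. Let $K$ be a finite (Hausdorff) CW-complex of dimension at most $2$ that is regular, i.e. the characteristic map of every cell is a homeomorphism onto the closed cell. Its face poset $\mathcal X(K)$ is the set of cells, ordered by $e\le e'$ iff $e\subseteq\overline{e'}$. An *acyclic matching* $M$ in $\mathcal X(K)$ is a set of pairs $(e,e')$ such that $e'$ covers $e$, every cell lies in at most one pair, and the Hasse diagram of $\mathcal X(K)$, with its edges directed from each cell to the cells covering it and the edges in $M$ then reversed, has no directed cycle. A cell is *critical* if it lies in no pair of $M$. A *boundary word* of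 a 2-cell $e$ is the cyclic sequence of oriented 1-cells traversed once by the attaching map of $e$, read from some starting vertex in one of the two directions (1-cells being oriented by their characteristic maps). For a spanning tree $T$ of the 1-skeleton $K^{(1)}$ and a choice of a boundary word for each 2-cell, the *standard presentation* $\mathcal P_K$ has as generators the 1-cells not in $T$, and for each 2-cell one relator, namely its boundary word with all letters from $T$ deleted. Suppose a generator $x$ occurs exactly once in a relator $r=w_1x^{\epsilon}w_2$, where $\epsilon=\pm1$ and $w_1,w_2$ do not involve $x$. The *equivalent expression* of $x$ induced by $r$ is $(w_1^{-1}w_2^{-1})^{\epsilon}$. *Eliminating* $(x,r)$ means removing $x$ and $r$ and replacing every occurrence of $x$ in the other relators by this expression. **Theorem.** Let $K$ be a finite regular CW-complex of dimension at most $2$, and let $M$ be an acyclic matching in $\mathcal X(K)$ with exactly one critical 0-cell. Then every 2-cell of $K$ has a boundary word, and the 1-cells that $M$ matches with 0-cells form (together with all the 0-cells) a spanning tree $T_M$ of $K^{(1)}$. Choose a boundary word for each 2-cell and let $\mathcal Q_0$ be the standard presentation of $K$ for $T_M$ and this choice. Let $(x_1,e_1),\dots,(x_m,e_m)$ be any enumeration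 without repetition of the pairs of $M$ consisting of a 1-cell and a 2-cell. For $i=0,\dots,m-1$, let $\mathcal Q_{i+1}$ be obtained from $\mathcal Q_i$ by eliminating the generator $x_{i+1}$ and the relator associated to $e_{i+1}$. This procedure is well defined, that is, at every step $x_{i+1}$ occurs exactly once in the current relator associated to $e_{i+1}$, and its result, the *Morse presentation* $\mathcal Q_{K,M}=\mathcal Q_m$, satisfies $$\mathcal Q_{K,M}\sim_{Q^{**}}\mathcal P_K$$ for every standard presentation $\mathcal P_K$ of $K$, that is, for every spanning tree of $K^{(1)}$ and every choice of boundary words. -/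

import Mathlib

universe u

/-! ## Finite group presentations and `Q**`-transformations -/

/-- A finite group presentation `⟨gens | rel j, j ∈ rels⟩`: a finite set of generators and a finite
family of relators in the free group on them (repeated and trivial relators are allowed). -/
structure GroupPres : Type (u + 1) where
  gens : Type u
  rels : Type u
  rel : rels → FreeGroup gens
  [finite_gens : Finite gens]
  [finite_rels : Finite rels]

namespace GroupPres

attribute [instance] GroupPres.finite_gens GroupPres.finite_rels

open Classical in
/-- One elementary transformation. The constructor `relabel` says that a presentation is only
considered up to the names of its generators and the order of its relators. -/
inductive QStep : GroupPres.{u} → GroupPres.{u} → Prop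
  /-- Replace a relator by its inverse. -/
  | inv (P : GroupPres.{u}) (i : P.rels) :
      QStep P { P with rel := Function.update P.rel i (P.rel i)⁻¹ }
  /-- Replace a relator `r i` by `r i * r j`, where `j ≠ i`. -/
  | mul (P : GroupPres.{u}) (i j : P.rels) (hij : j ≠ i) :
      QStep P { P with rel := Function.update P.rel i (P.rel i * P.rel j) }
  /-- Replace a relator by a conjugate. -/
  | conj (P : GroupPres.{u}) (i : P.rels) (w : FreeGroup P.gens) :
      QStep P { P with rel := Function.update P.rel i (w * P.rel i * w⁻¹) }
  /-- Add a new generator together with a relator equal to it. -/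
  | stab (P : GroupPres.{u}) :
      QStep P
        { gens := Option P.gens
          rels := Option P.rels
          rel := fun j => j.elim (FreeGroup.of none) (fun k => FreeGroup.map some (P.rel k)) }
  /-- Apply an automorphism of the free group to all the relators. -/
  | aut (P : GroupPres.{u}) (φ : FreeGroup P.gens ≃* FreeGroup P.gens) :
      QStep P { P with rel := fun j => φ (P.rel j) }
  /-- Rename the generators and reindex the relators. -/
  | relabel (P P' : GroupPres.{u}) (f : P.gens ≃ P'.gens) (g : P.rels ≃ P'.rels)
      (h : ∀ j, P'.rel (g j) = FreeGroup.map f (P.rel j)) : QStep P P'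

/-- `Q**`-equivalence: a finite sequence of the elementary transformations and their inverses. -/
def QEquiv : GroupPres.{u} → GroupPres.{u} → Prop :=
  Relation.EqvGen QStep

/-- `u` is the equivalent expression of the generator `x` induced by the relator `r` with index `j`:
`r` is of the form `w₁ x^ε w₂` with `ε = ±1`, where `w₁` and `w₂` are words in the generators
other than `x`, and `u = (w₁⁻¹ w₂⁻¹)^ε`. -/
def IsEquivExpr (P : GroupPres.{u}) (x : P.gens) (j : P.rels)
    (u : FreeGroup {y : P.gens // y ≠ x}) : Prop :=
  ∃ (w₁ w₂ : FreeGroup {y : P.gens // y ≠ x}) (ε : ℤ), (ε = 1 ∨ ε = -1) ∧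
    P.rel j = FreeGroup.map Subtype.val w₁ * FreeGroup.of x ^ ε * FreeGroup.map Subtype.val w₂ ∧
    u = (w₁⁻¹ * w₂⁻¹) ^ ε

open Classical in
/-- Remove the generator `x` and the relator with index `j`, and replace every occurrence of `x` in
the other relators by `u`. -/
noncomputable def eliminate (P : GroupPres.{u}) (x : P.gens) (j : P.rels)
    (u : FreeGroup {y : P.gens // y ≠ x}) : GroupPres.{u} where
  gens := {y : P.gens // y ≠ x}
  rels := {k : P.rels // k ≠ j}
  rel := fun k =>
    FreeGroup.lift (fun y => if h : y = x then u else FreeGroup.of ⟨y, h⟩) (P.rel k.1)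

/-- `IsReduction P l Q`: starting from `P`, one can eliminate successively, for the pairs `(x, j)` of
the list `l` in this order, the generator `x` and the relator with index `j`, using at every step
the equivalent expression of `x` induced by the current relator with index `j`, and the result
is `Q`. -/
inductive IsReduction : (P : GroupPres.{u}) → List (P.gens × P.rels) → GroupPres.{u} → Prop
  | nil (P : GroupPres.{u}) : IsReduction P [] P
  | cons (P : GroupPres.{u}) (x : P.gens) (j : P.rels) (u : FreeGroup {y : P.gens // y ≠ x})
      (hu : P.IsEquivExpr x j u)
      (l : List ({y : P.gens // y ≠ x} × {k : P.rels // k ≠ j})) (Q : GroupPres.{u})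
      (hl : IsReduction (P.eliminate x j u) l Q) :
      IsReduction P ((x, j) :: l.map (Prod.map Subtype.val Subtype.val)) Q

end GroupPres

/-! ## Regular CW-complexes, face posets and acyclic matchings -/

namespace CWMorse

open Topology Set Metric
open Topology.RelCWComplex (cell map openCell closedCell)

section

variable {X : Type u} [TopologicalSpace X] (C : Set X) [CWComplex C]

/-- A CW-complex is regular if every characteristic map is a homeomorphism from the closed ball onto
the closed cell. -/
def IsRegular : Prop :=
  ∀ (n : ℕ) (i : cell C n), IsEmbedding ((closedBall (0 : Fin n → ℝ) 1).domRestrict (map n i))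

/-- The set of all the cells of a CW-complex. -/
abbrev Cells : Type u := Σ n, cell C n

variable {C}

/-- `e` is a face of `e'`: the open cell `e` is contained in the closure of `e'`. -/
def IsFace (e e' : Cells C) : Prop := openCell e.1 e.2 ⊆ closedCell e'.1 e'.2

/-- `e'` covers `e` in the face poset. -/
def Covers (e e' : Cells C) : Prop :=
  (IsFace e e' ∧ e ≠ e') ∧
    ¬ ∃ e'' : Cells C, (IsFace e e'' ∧ e ≠ e'') ∧ (IsFace e'' e' ∧ e'' ≠ e')

/-- The edges of the directed graph obtained from the Hasse diagram of the face poset (whose edges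
are the pairs `(e, e')` such that `e'` covers `e`) by reversing the edges in `M`. -/
def ModifiedHasse (M : Set (Cells C × Cells C)) (e e' : Cells C) : Prop :=
  (Covers e e' ∧ (e, e') ∉ M) ∨ (Covers e' e ∧ (e', e) ∈ M)

/-- Acyclic matchings in the face poset. -/
structure IsAcyclicMatching (M : Set (Cells C × Cells C)) : Prop where
  covers : ∀ p ∈ M, Covers p.1 p.2
  matching : ∀ p ∈ M, ∀ q ∈ M, ∀ c : Cells C,
    (c = p.1 ∨ c = p.2) → (c = q.1 ∨ c = q.2) → p = q
  acyclic : ∀ c : Cells C, ¬ Relation.TransGen (ModifiedHasse M) c c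

/-- A cell is critical if it belongs to no pair of the matching. -/
def IsCritical (M : Set (Cells C × Cells C)) (c : Cells C) : Prop :=
  ∀ p ∈ M, c ≠ p.1 ∧ c ≠ p.2

/-! ## Edge paths, spanning trees and boundary words

A pair `(x, true)` stands for the 1-cell `x` traversed in the direction given by its characteristic
map `[-1, 1] → X`, and `(x, false)` for the 1-cell `x` traversed in the opposite direction. -/

/-- The 0-cell `v`, as a point. -/
def vertexPt (v : cell C 0) : X := map 0 v 0

/-- The initial point of an oriented 1-cell. -/
def src (a : cell C 1 × Bool) : X := map 1 a.1 (fun _ => if a.2 then -1 else 1)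

/-- The final point of an oriented 1-cell. -/
def tgt (a : cell C 1 × Bool) : X := map 1 a.1 (fun _ => if a.2 then 1 else -1)

/-- `w` is an edge path from `p` to `q` in the 1-skeleton. -/
def IsEdgePath : List (cell C 1 × Bool) → X → X → Prop
  | [], p, q => p = q
  | a :: w, p, q => src a = p ∧ IsEdgePath w (tgt a) q

/-- The set `T` of 1-cells, together with all the 0-cells, is a spanning tree of the 1-skeleton: it
is connected and has no closed edge path of positive length without repeated 1-cells. -/
structure IsSpanningTree (T : Set (cell C 1)) : Prop where
  nonempty : Nonempty (cell C 0)
  connected : ∀ v v' : cell C 0, ∃ w : List (cell C 1 × Bool),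
    (∀ a ∈ w, a.1 ∈ T) ∧ IsEdgePath w (vertexPt v) (vertexPt v')
  acyclic : ∀ (w : List (cell C 1 × Bool)) (p : X), w ≠ [] → (∀ a ∈ w, a.1 ∈ T) →
    (w.map Prod.fst).Nodup → ¬ IsEdgePath w p p

/-- `w` is a word of oriented 1-cells induced by the attaching map of the 2-cell `e` of a regular
CW-complex: for some parametrization `γ` of the boundary circle of the 2-ball (which chooses a
starting point and a direction) and some subdivision `0 = t 0 < ⋯ < t k = 1`, the attaching map
carries the `i`-th open arc onto the `i`-th open 1-cell of `w`, in the direction given by `w`. (The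
attaching map is injective here, so the arcs are carried homeomorphically, and the two ends of a
1-cell are distinct, so the direction is determined by the images of the ends of the arc.) -/
def IsBoundaryWord (e : cell C 2) (w : List (cell C 1 × Bool)) : Prop :=
  ∃ (γ : ℝ → Fin 2 → ℝ) (t : ℕ → ℝ),
    ContinuousOn γ (Icc 0 1) ∧ γ 0 = γ 1 ∧ InjOn γ (Ico 0 1) ∧ γ '' Icc 0 1 = sphere 0 1 ∧
    t 0 = 0 ∧ t w.length = 1 ∧ (∀ i < w.length, t i < t (i + 1)) ∧
    ∀ (i : ℕ) (hi : i < w.length),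
      (fun s => map 2 e (γ s)) '' Ioo (t i) (t (i + 1)) = openCell 1 w[i].1 ∧
      map 2 e (γ (t i)) = src w[i] ∧ map 2 e (γ (t (i + 1))) = tgt w[i]

/-! ## The standard presentation and the Morse presentation -/

open Classical in
/-- The word obtained from `w` by deleting the 1-cells in `T`. -/
noncomputable def deleteTree (T : Set (cell C 1)) (w : List (cell C 1 × Bool)) :
    List ({x : cell C 1 // x ∉ T} × Bool) :=
  w.filterMap fun a => if h : a.1 ∈ T then none else some (⟨a.1, h⟩, a.2)

/-- The standard presentation of a finite 2-dimensional CW-complex, for the spanning tree `T` and the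
boundary words `b` of the 2-cells: the generators are the 1-cells that are not in `T`, and there is
one relator for every 2-cell `e`, read off from `b e` after collapsing `T`. -/
noncomputable def standardPres [CWComplex.Finite C] (T : Set (cell C 1))
    (b : cell C 2 → List (cell C 1 × Bool)) : GroupPres.{u} where
  gens := {x : cell C 1 // x ∉ T}
  rels := cell C 2
  rel := fun e => FreeGroup.mk (deleteTree T (b e))
  finite_gens := by
    have : Finite (cell C 1) := CWComplex.FiniteType.finite_cell 1
    infer_instance
  finite_rels := CWComplex.FiniteType.finite_cell 2

/-- The set of 1-cells that `M` matches with 0-cells. -/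
def treeOf (M : Set (Cells C × Cells C)) : Set (cell C 1) :=
  {x | ∃ v : cell C 0, ((⟨0, v⟩, ⟨1, x⟩) : Cells C × Cells C) ∈ M}

/-- The initial presentation of the reduction: the standard presentation for the spanning tree
induced by `M`. -/
noncomputable def initialPres [CWComplex.Finite C] (M : Set (Cells C × Cells C))
    (b : cell C 2 → List (cell C 1 × Bool)) : GroupPres.{u} :=
  standardPres (treeOf M) b

/-- `l` lists, without repetition, the pairs of `M` that consist of a 1-cell and a 2-cell (in a
matching, such a 1-cell is never in `treeOf M`). -/
def Enumerates (M : Set (Cells C × Cells C)) (l : List ({x : cell C 1 // x ∉ treeOf M} × cell C 2)) :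
    Prop :=
  l.Nodup ∧ ∀ (x : {x : cell C 1 // x ∉ treeOf M}) (e : cell C 2),
    (x, e) ∈ l ↔ ((⟨1, x.1⟩, ⟨2, e⟩) : Cells C × Cells C) ∈ M

/-- `Q` is the Morse presentation, for the boundary words `b` and the enumeration `l` of the matched
pairs of 1-cells and 2-cells. -/
def IsMorsePres [CWComplex.Finite C] (M : Set (Cells C × Cells C))
    (b : cell C 2 → List (cell C 1 × Bool))
    (l : List ({x : cell C 1 // x ∉ treeOf M} × cell C 2)) (Q : GroupPres.{u}) : Prop :=
  Enumerates M l ∧ GroupPres.IsReduction (initialPres M b) l Q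

end

end CWMorse

/-!
The Morse presentation is obtained from a standard presentation by eliminations, so the equivalence
has two halves.

*Elimination.* If `x` occurs once in a relator `r`, then `r` is conjugate, up to inversion, to
`x u⁻¹`, where `u` is the equivalent expression of `x`. The automorphism `x ↦ x u` turns this relator
into the generator `x`, which can then be removed from the other relators and destabilized; hence
eliminating is a `Q**`-equivalence (`IsEquivExpr.qEquiv_eliminate`). That the matched pairs can be
eliminated in any order follows from acyclicity: if `(x, e)` is matched and `y ≠ x` is another 1-cell
in the boundary of `e`, then `y → e → x` is a path in the modified Hasse diagram. So `x` is the letter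
of largest rank of the relator of `e`, and it occurs once. Substituting for a generator an expression
in generators of smaller rank preserves this property of the remaining pairs (`exists_isReduction`).

*Independence of the choices.* In a tree, every closed edge path is trivial in the free group on the
1-cells (`IsSpanningTree.mk_eq_one`), so a spanning tree `T` gives each 0-cell `p` a word `g p` of `T`
leading to it from a base point. For two spanning trees `T` and `T'`, sending a 1-cell `x` from `p` to
`q` to the word `g p * x * (g q)⁻¹` with the letters of `T'` deleted defines mutually inverse
isomorphisms of the free groups, and these carry relators to conjugates of relators
(`IsSpanningTree.qEquiv_standardPres`). An isomorphism of free groups with this property gives a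
`Q**`-equivalence, because the ranks are equal (`qEquiv_of_mulEquiv`). Two boundary words of a 2-cell
are simple closed edge paths through the same 1-cells, and these agree up to rotation and inversion
(`IsSimpleCycle.isConj_or`), so their relators are conjugate up to inversion.

The topology enters through the fact that the boundary circle of a 2-cell runs through whole
1-cells (`IsRegular.exists_isBoundaryWord`). The points of the circle over 0-cells cut it into finitely
many arcs, each of them over one open 1-cell; the coordinate of such an arc is a continuous injective
function on an interval, so it takes different values at the two ends. As the ends lie over 0-cells,
these values are `-1` and `1`, and the arc covers the 1-cell.
-/

namespace GroupPres

open Function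

/-! ### `Q**`-equivalence of presentations -/

theorem QStep.qEquiv {P Q : GroupPres.{u}} (h : QStep P Q) : QEquiv P Q :=
  Relation.EqvGen.rel _ _ h

@[refl]
theorem QEquiv.refl (P : GroupPres.{u}) : QEquiv P P :=
  Relation.EqvGen.refl P

@[symm]
theorem QEquiv.symm {P Q : GroupPres.{u}} (h : QEquiv P Q) : QEquiv Q P :=
  Relation.EqvGen.symm _ _ h

theorem QEquiv.trans {P Q R : GroupPres.{u}} (h : QEquiv P Q) (h' : QEquiv Q R) : QEquiv P R :=
  Relation.EqvGen.trans _ _ _ h h'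

/-- The presentation with the same generators and relator indices as `P`, but with relators `r`. -/
abbrev withRel (P : GroupPres.{u}) (r : P.rels → FreeGroup P.gens) : GroupPres.{u} :=
  { P with rel := r }

section

variable (P : GroupPres.{u})

variable {P} in
theorem qEquiv_withRel_congr {r r' : P.rels → FreeGroup P.gens} (h : ∀ k, r k = r' k) :
    QEquiv (P.withRel r) (P.withRel r') := by
  rw [funext h]

open Classical in
theorem qEquiv_inv (r : P.rels → FreeGroup P.gens) (i : P.rels) :
    QEquiv (P.withRel r) (P.withRel (update r i (r i)⁻¹)) :=
  (QStep.inv (P.withRel r) i).qEquiv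

open Classical in
theorem qEquiv_mul (r : P.rels → FreeGroup P.gens) {i j : P.rels} (hij : j ≠ i) :
    QEquiv (P.withRel r) (P.withRel (update r i (r i * r j))) :=
  (QStep.mul (P.withRel r) i j hij).qEquiv

open Classical in
theorem qEquiv_conj (r : P.rels → FreeGroup P.gens) (i : P.rels) (w : FreeGroup P.gens) :
    QEquiv (P.withRel r) (P.withRel (update r i (w * r i * w⁻¹))) :=
  (QStep.conj (P.withRel r) i w).qEquiv

open Classical in
theorem qEquiv_update_of_isConj (r : P.rels → FreeGroup P.gens) (i : P.rels)
    {a : FreeGroup P.gens} (h : IsConj (r i) a) :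
    QEquiv (P.withRel r) (P.withRel (update r i a)) := by
  obtain ⟨c, rfl⟩ := isConj_iff.1 h
  exact P.qEquiv_conj r i c

open Classical in
theorem qEquiv_update_of_isConj_inv (r : P.rels → FreeGroup P.gens) (i : P.rels)
    {a : FreeGroup P.gens} (h : IsConj (r i)⁻¹ a) :
    QEquiv (P.withRel r) (P.withRel (update r i a)) := by
  refine (P.qEquiv_inv r i).trans ?_
  simpa using P.qEquiv_update_of_isConj (update r i (r i)⁻¹) i (a := a) (by simpa using h)

open Classical in
/-- A relator may be multiplied by any consequence of a single other relator. -/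
theorem qEquiv_update_mul_of_mem_normalClosure (r : P.rels → FreeGroup P.gens) {i j : P.rels}
    (hij : j ≠ i) {n : FreeGroup P.gens} (hn : n ∈ Subgroup.normalClosure {r j}) :
    QEquiv (P.withRel r) (P.withRel (update r i (r i * n))) := by
  suffices H : ∀ a, QEquiv (P.withRel (update r i a)) (P.withRel (update r i (a * n))) by
    simpa using H (r i)
  induction hn using Subgroup.closure_induction with
  | mem n hn =>
    intro a
    obtain ⟨_, rfl, h⟩ := Group.mem_conjugatesOfSet_iff.1 hn
    obtain ⟨c, rfl⟩ := isConj_iff.1 h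
    -- conjugate the relator `r j`, multiply by it, and conjugate it back
    refine (P.qEquiv_conj _ j c).trans ((P.qEquiv_mul _ hij).trans ?_)
    refine (P.qEquiv_conj _ j c⁻¹).trans (qEquiv_withRel_congr fun k => ?_)
    by_cases hk : k = j
    · subst hk
      simp [hij, mul_assoc]
    · by_cases hk' : k = i
      · subst hk'
        simp [hij, hk]
      · simp [hk, hk']
  | one => intro a; simpa using QEquiv.refl _
  | mul m n _ _ hm hn =>
    intro a
    simpa [mul_assoc] using (hm a).trans (hn (a * m))
  | inv n _ hn =>
    intro a
    simpa using (hn (a * n⁻¹)).symm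

open Classical in
/-- Relators may be replaced all at once if they may be replaced one at a time. -/
theorem qEquiv_of_forall_update (f : P.rels → FreeGroup P.gens)
    (h : ∀ (s : P.rels → FreeGroup P.gens) (i : P.rels), s i = P.rel i →
      (∀ k, s k = P.rel k ∨ s k = f k) →
      QEquiv (P.withRel s) (P.withRel (update s i (f i)))) :
    QEquiv P (P.withRel f) := by
  have := Fintype.ofFinite P.rels
  suffices H : ∀ S : Finset P.rels,
      QEquiv P (P.withRel fun k => if k ∈ S then f k else P.rel k) by
    simpa using H Finset.univ
  intro S
  induction S using Finset.induction_on with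
  | empty => simpa using QEquiv.refl P
  | insert i S hi ih =>
    refine ih.trans ?_
    refine (h (fun k => if k ∈ S then f k else P.rel k) i (by simp [hi]) fun k => ?_).trans
      (qEquiv_withRel_congr fun k => ?_)
    · by_cases hk : k ∈ S <;> simp [hk]
    · by_cases hk : k = i
      · subst hk
        simp
      · simp [hk]

/-- All the relators may be multiplied by consequences of the relator with index `j`, as long as
that relator itself does not change. -/
theorem qEquiv_of_forall_mem_normalClosure (f : P.rels → FreeGroup P.gens) (j : P.rels)
    (hj : f j = P.rel j) (h : ∀ k, (P.rel k)⁻¹ * f k ∈ Subgroup.normalClosure {P.rel j}) :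
    QEquiv P (P.withRel f) := by
  classical
  refine P.qEquiv_of_forall_update f fun s i hi hs => ?_
  have hsj : s j = P.rel j := (hs j).elim id fun H => H.trans hj
  by_cases hij : j = i
  · subst hij
    rw [hj, ← hi, update_eq_self]
  · have := P.qEquiv_update_mul_of_mem_normalClosure s hij (n := (P.rel i)⁻¹ * f i)
      (by rw [hsj]; exact h i)
    rwa [hi, mul_inv_cancel_left] at this

end

/-- An isomorphism of free groups that carries the relators of `P` to the relators of `P'`, up to
conjugation and inversion, gives a `Q**`-equivalence: the two free groups have the same rank, so
the isomorphism is an automorphism followed by a renaming of the generators. -/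
theorem qEquiv_of_mulEquiv (P P' : GroupPres.{u}) (ψ : FreeGroup P.gens ≃* FreeGroup P'.gens)
    (g : P.rels ≃ P'.rels)
    (h : ∀ j, IsConj (ψ (P.rel j)) (P'.rel (g j)) ∨ IsConj (ψ (P.rel j))⁻¹ (P'.rel (g j))) :
    QEquiv P P' := by
  classical
  let e : P.gens ≃ P'.gens := Equiv.ofFreeGroupEquiv ψ
  let φ : FreeGroup P.gens ≃* FreeGroup P.gens := ψ.trans (FreeGroup.freeGroupCongr e.symm)
  let P₁ : GroupPres.{u} := P'.withRel fun j => ψ (P.rel (g.symm j))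
  have h₁ : QEquiv P (P.withRel fun j => φ (P.rel j)) := (QStep.aut P φ).qEquiv
  have h₂ : QEquiv (P.withRel fun j => φ (P.rel j)) P₁ := by
    refine (QStep.relabel (P.withRel fun j => φ (P.rel j)) P₁ e g fun j => ?_).qEquiv
    simp [P₁, φ, FreeGroup.map.comp]
  refine h₁.trans (h₂.trans (P₁.qEquiv_of_forall_update P'.rel fun s i hi _ => ?_))
  have := h (g.symm i)
  rw [Equiv.apply_symm_apply] at this
  rcases this with H | H
  · exact P₁.qEquiv_update_of_isConj s i (by rw [hi]; exact H)
  · exact P₁.qEquiv_update_of_isConj_inv s i (by rw [hi]; exact H)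

/-! ### Eliminating a generator -/

section Eliminate

variable {α : Type u} {x : α}

open Classical in
/-- The substitution of `u` for the generator `x`. -/
noncomputable def subst (x : α) (u : FreeGroup {y : α // y ≠ x}) :
    FreeGroup α →* FreeGroup {y : α // y ≠ x} :=
  FreeGroup.lift fun y => if h : y = x then u else FreeGroup.of ⟨y, h⟩

@[simp]
theorem subst_of_self (u : FreeGroup {y : α // y ≠ x}) : subst x u (FreeGroup.of x) = u := by
  simp [subst]

theorem subst_of_ne (u : FreeGroup {y : α // y ≠ x}) {y : α} (h : y ≠ x) :
    subst x u (FreeGroup.of y) = FreeGroup.of ⟨y, h⟩ := by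
  simp [subst, h]

open Classical in
/-- The endomorphism of the free group that multiplies the generator `x` by `u` on the right. -/
noncomputable def transvection (x : α) (u : FreeGroup {y : α // y ≠ x}) :
    FreeGroup α →* FreeGroup α :=
  FreeGroup.lift fun y =>
    if y = x then FreeGroup.of x * FreeGroup.map Subtype.val u else FreeGroup.of y

@[simp]
theorem transvection_of_self (u : FreeGroup {y : α // y ≠ x}) :
    transvection x u (FreeGroup.of x) = FreeGroup.of x * FreeGroup.map Subtype.val u := by
  simp [transvection]

theorem transvection_of_ne (u : FreeGroup {y : α // y ≠ x}) {y : α} (h : y ≠ x) :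
    transvection x u (FreeGroup.of y) = FreeGroup.of y := by
  simp [transvection, h]

@[simp]
theorem transvection_map_val (u w : FreeGroup {y : α // y ≠ x}) :
    transvection x u (FreeGroup.map Subtype.val w) = FreeGroup.map Subtype.val w := by
  have : (transvection x u).comp (FreeGroup.map Subtype.val) =
      FreeGroup.map (Subtype.val : {y : α // y ≠ x} → α) := by
    ext y
    simp [transvection_of_ne u y.2]
  exact DFunLike.congr_fun this w

theorem transvection_comp_inv (u : FreeGroup {y : α // y ≠ x}) :
    (transvection x u).comp (transvection x u⁻¹) = MonoidHom.id _ := by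
  ext y
  by_cases h : y = x
  · subst h
    simp
  · simp [transvection_of_ne _ h]

/-- The automorphism of the free group that multiplies the generator `x` by `u` on the right. -/
noncomputable def transvectionEquiv (x : α) (u : FreeGroup {y : α // y ≠ x}) :
    FreeGroup α ≃* FreeGroup α :=
  (transvection x u).toMulEquiv (transvection x u⁻¹)
    (by simpa using transvection_comp_inv u⁻¹) (transvection_comp_inv u)

@[simp]
theorem transvectionEquiv_apply (u : FreeGroup {y : α // y ≠ x}) (w : FreeGroup α) :
    transvectionEquiv x u w = transvection x u w := rfl

/-- Modulo `x`, multiplying `x` by `u` is the same as substituting `u` for `x`. -/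
theorem transvection_inv_mul_subst_mem (u : FreeGroup {y : α // y ≠ x}) (w : FreeGroup α) :
    (transvection x u w)⁻¹ * FreeGroup.map Subtype.val (subst x u w) ∈
      Subgroup.normalClosure {FreeGroup.of x} := by
  rw [← QuotientGroup.eq]
  let q := QuotientGroup.mk' (Subgroup.normalClosure {FreeGroup.of x})
  have : q.comp (transvection x u) =
      q.comp ((FreeGroup.map Subtype.val).comp (subst x u)) := by
    ext y
    by_cases h : y = x
    · subst h
      have hx : q (FreeGroup.of y) = 1 :=
        (QuotientGroup.eq_one_iff _).2 (Subgroup.subset_normalClosure rfl)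
      simp [hx]
    · simp [transvection_of_ne u h, subst_of_ne u h]
  exact DFunLike.congr_fun this w

end Eliminate

open Classical in
/-- Eliminating a generator is a `Q**`-equivalence: the relator `w₁ x^ε w₂` is conjugate, up to
inversion, to `x u⁻¹`, which the automorphism `x ↦ x u` carries to `x`. Then `x` is removed from the
other relators by multiplying them by consequences of the relator `x`. -/
theorem IsEquivExpr.qEquiv_eliminate {P : GroupPres.{u}} {x : P.gens} {j : P.rels}
    {u : FreeGroup {y : P.gens // y ≠ x}} (h : P.IsEquivExpr x j u) :
    QEquiv P (P.eliminate x j u) := by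
  obtain ⟨w₁, w₂, ε, hε, hj, hu⟩ := h
  let r₁ : P.rels → FreeGroup P.gens :=
    update P.rel j (FreeGroup.of x * (FreeGroup.map Subtype.val u)⁻¹)
  have h₁ : QEquiv P (P.withRel r₁) := by
    rcases hε with rfl | rfl
    · refine P.qEquiv_update_of_isConj P.rel j (isConj_iff.2
        ⟨(FreeGroup.map Subtype.val w₁)⁻¹, ?_⟩)
      rw [hj, hu]
      simp [mul_assoc]
    · refine P.qEquiv_update_of_isConj_inv P.rel j (isConj_iff.2
        ⟨FreeGroup.map Subtype.val w₂, ?_⟩)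
      rw [hj, hu]
      simp [mul_assoc]
  let P₂ : GroupPres.{u} := P.withRel fun k => transvection x u (r₁ k)
  have h₂ : QEquiv (P.withRel r₁) P₂ :=
    (QStep.aut (P.withRel r₁) (transvectionEquiv x u)).qEquiv
  have hj₂ : P₂.rel j = FreeGroup.of x := by simp [P₂, r₁]
  let r₃ : P.rels → FreeGroup P.gens := fun k =>
    if k = j then FreeGroup.of x else FreeGroup.map Subtype.val (subst x u (P.rel k))
  have h₃ : QEquiv P₂ (P.withRel r₃) := by
    refine P₂.qEquiv_of_forall_mem_normalClosure r₃ j (by simp [hj₂, r₃]) fun k => ?_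
    rw [hj₂]
    by_cases hk : k = j
    · simp [hk, hj₂, r₃]
    ·       simpa [P₂, r₁, r₃, hk] using transvection_inv_mul_subst_mem u (P.rel k)
  have h₄ := (QStep.stab (P.eliminate x j u)).qEquiv
  refine h₁.trans (h₂.trans (h₃.trans (h₄.trans (QStep.relabel _ (P.withRel r₃)
    (Equiv.optionSubtypeNe x) (Equiv.optionSubtypeNe j) fun k => ?_).qEquiv).symm))
  match k with
  | none =>
    change r₃ (Equiv.optionSubtypeNe j none) =
      FreeGroup.map (Equiv.optionSubtypeNe x) (FreeGroup.of none)
    simp [r₃]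
  | some k =>
    change r₃ (Equiv.optionSubtypeNe j (some k)) = FreeGroup.map (Equiv.optionSubtypeNe x)
      (FreeGroup.map some (subst x u (P.rel k.1)))
    have hval : (Equiv.optionSubtypeNe x ∘ some : {y : P.gens // y ≠ x} → P.gens) =
        Subtype.val := by
      ext y
      simp
    rw [FreeGroup.map.comp, hval]
    exact (congrArg r₃ (Equiv.optionSubtypeNe_some j k)).trans (if_neg k.2)

theorem IsReduction.qEquiv {P Q : GroupPres.{u}} {l : List (P.gens × P.rels)}
    (h : IsReduction P l Q) : QEquiv P Q := by
  induction h with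
  | nil P => exact QEquiv.refl P
  | cons P x j u hu l Q _ ih => exact hu.qEquiv_eliminate.trans ih

/-! ### Existence of the reduction -/

/-- The subgroup of words in the generators of rank less than `n`. -/
def belowRank {α : Type u} (ρ : α → ℕ) (n : ℕ) : Subgroup (FreeGroup α) :=
  Subgroup.closure (FreeGroup.of '' {y | ρ y < n})

theorem belowRank_mono {α : Type u} (ρ : α → ℕ) {m n : ℕ} (h : m ≤ n) :
    belowRank ρ m ≤ belowRank ρ n :=
  Subgroup.closure_mono (Set.image_mono fun _ hy => lt_of_lt_of_le hy h)

theorem of_mem_belowRank {α : Type u} {ρ : α → ℕ} {n : ℕ} {y : α} (h : ρ y < n) :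
    FreeGroup.of y ∈ belowRank ρ n :=
  Subgroup.subset_closure ⟨y, h, rfl⟩

theorem exists_map_val_eq_of_mem_belowRank {α : Type u} {ρ : α → ℕ} {x : α} {w : FreeGroup α}
    (hw : w ∈ belowRank ρ (ρ x)) :
    ∃ w' ∈ belowRank (fun y : {y : α // y ≠ x} => ρ y.1) (ρ x),
      FreeGroup.map Subtype.val w' = w := by
  suffices H : belowRank ρ (ρ x) ≤ (belowRank (fun y : {y : α // y ≠ x} => ρ y.1) (ρ x)).map
      (FreeGroup.map Subtype.val) from H hw
  rw [belowRank, Subgroup.closure_le]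
  rintro _ ⟨y, hy, rfl⟩
  exact ⟨FreeGroup.of ⟨y, fun h => (ne_of_lt hy) (congrArg ρ h)⟩, of_mem_belowRank hy, by simp⟩

theorem subst_mem_belowRank {α : Type u} {ρ : α → ℕ} {x : α} {u : FreeGroup {y : α // y ≠ x}}
    (hu : u ∈ belowRank (fun y : {y : α // y ≠ x} => ρ y.1) (ρ x)) {n : ℕ} {w : FreeGroup α}
    (hw : w ∈ belowRank ρ n) :
    subst x u w ∈ belowRank (fun y : {y : α // y ≠ x} => ρ y.1) n := by
  suffices H : belowRank ρ n ≤ (belowRank (fun y : {y : α // y ≠ x} => ρ y.1) n).comap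
      (subst x u) from H hw
  rw [belowRank, Subgroup.closure_le]
  rintro _ ⟨y, hy, rfl⟩
  by_cases h : y = x
  · subst h
    simpa using belowRank_mono _ (le_of_lt hy) hu
  · simpa [subst_of_ne u h] using of_mem_belowRank (ρ := fun y : {y : α // y ≠ x} => ρ y.1) hy

/-- The relator with index `j` is of the form `w₁ x^ε w₂`, where the generators in `w₁` and `w₂` have
rank less than `x`. -/
def IsLeading (P : GroupPres.{u}) (ρ : P.gens → ℕ) (x : P.gens) (j : P.rels) : Prop :=
  ∃ w₁ ∈ belowRank ρ (ρ x), ∃ w₂ ∈ belowRank ρ (ρ x), ∃ ε : ℤ, (ε = 1 ∨ ε = -1) ∧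
    P.rel j = w₁ * FreeGroup.of x ^ ε * w₂

/-- If every pair of `l` consists of a relator and of its unique generator of largest rank, then the
pairs can be eliminated in the order of `l`, whatever this order is: substituting for a generator
an expression in generators of smaller rank preserves the hypothesis on the remaining pairs. -/
theorem exists_isReduction (P : GroupPres.{u}) (ρ : P.gens → ℕ) (l : List (P.gens × P.rels))
    (h₁ : (l.map Prod.fst).Nodup) (h₂ : (l.map Prod.snd).Nodup)
    (h : ∀ p ∈ l, P.IsLeading ρ p.1 p.2) : ∃ Q, IsReduction P l Q := by
  induction hn : l.length generalizing P with
  | zero =>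
    obtain rfl := List.length_eq_zero_iff.1 hn
    exact ⟨P, .nil P⟩
  | succ n ih =>
    obtain - | ⟨⟨x, j⟩, l⟩ := l
    · simp at hn
    obtain ⟨w₁, hw₁, w₂, hw₂, ε, hε, hj⟩ := h (x, j) (by simp)
    obtain ⟨v₁, hv₁, rfl⟩ := exists_map_val_eq_of_mem_belowRank hw₁
    obtain ⟨v₂, hv₂, rfl⟩ := exists_map_val_eq_of_mem_belowRank hw₂
    set u : FreeGroup {y : P.gens // y ≠ x} := (v₁⁻¹ * v₂⁻¹) ^ ε with hu
    have hu' : u ∈ belowRank (fun y : {y : P.gens // y ≠ x} => ρ y.1) (ρ x) :=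
      zpow_mem (mul_mem (inv_mem hv₁) (inv_mem hv₂)) _
    have hexpr : P.IsEquivExpr x j u := ⟨v₁, v₂, ε, hε, hj, hu⟩
    simp only [List.map_cons, List.nodup_cons, List.mem_map, not_exists, not_and] at h₁ h₂
    obtain ⟨l, rfl⟩ : ∃ l' : List ({y : P.gens // y ≠ x} × {k : P.rels // k ≠ j}),
        l'.map (Prod.map Subtype.val Subtype.val) = l := by
      have : l ∈ Set.range (List.map (Prod.map Subtype.val Subtype.val :
          {y : P.gens // y ≠ x} × {k : P.rels // k ≠ j} → P.gens × P.rels)) := by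
        rw [Set.range_list_map]
        intro p hp
        exact ⟨(⟨p.1, h₁.1 p hp⟩, ⟨p.2, h₂.1 p hp⟩), rfl⟩
      exact this
    have hn' : l.length = n := by simpa using hn
    have h₁' : (l.map Prod.fst).Nodup := by
      refine List.Nodup.of_map Subtype.val ?_
      rw [List.map_map]
      exact (List.map_map ▸ h₁.2 :)
    have h₂' : (l.map Prod.snd).Nodup := by
      refine List.Nodup.of_map Subtype.val ?_
      rw [List.map_map]
      exact (List.map_map ▸ h₂.2 :)
    obtain ⟨Q, hQ⟩ := ih (P.eliminate x j u) (fun y => ρ y.1) l h₁' h₂'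
      (by
        intro p hp
        obtain ⟨a, ha, b, hb, δ, hδ, hab⟩ := h (Prod.map Subtype.val Subtype.val p)
          (List.mem_cons_of_mem _ (List.mem_map_of_mem hp))
        refine ⟨subst x u a, subst_mem_belowRank hu' ha, subst x u b, subst_mem_belowRank hu' hb,
          δ, hδ, ?_⟩
        change subst x u (P.rel p.2.1) = _
        erw [hab]
        rw [map_mul, map_mul, map_zpow]
        erw [subst_of_ne u p.1.2]
        rfl)
      hn'
    exact ⟨Q, .cons P x j u hexpr l Q hQ⟩

end GroupPres

namespace CWMorse

open Topology Set Metric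
open Topology.RelCWComplex (cell map openCell closedCell cellFrontier)

section

variable {X : Type u} [TopologicalSpace X] {C : Set X} [CWComplex C]

/-! ### Edge paths in the 1-skeleton -/

theorem vertexPt_injective : Function.Injective (vertexPt : cell C 0 → X) := by
  intro v v' h
  refine RelCWComplex.injective_map_zero C ?_
  simpa [vertexPt, Matrix.empty_eq] using h

theorem closedCell_zero (v : cell C 0) : closedCell 0 v = {vertexPt v} := by
  rw [RelCWComplex.closedCell_zero_eq_singleton, vertexPt, Matrix.empty_eq 0]

theorem openCell_zero (v : cell C 0) : openCell 0 v = {vertexPt v} := by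
  rw [RelCWComplex.openCell_zero_eq_singleton, vertexPt, Matrix.empty_eq 0]

theorem src_not (x : cell C 1) (s : Bool) : src (x, !s) = tgt (x, s) := by
  cases s <;> rfl

theorem tgt_not (x : cell C 1) (s : Bool) : tgt (x, !s) = src (x, s) := by
  cases s <;> rfl

theorem src_mem_cellFrontier (a : cell C 1 × Bool) : src a ∈ cellFrontier 1 a.1 := by
  refine ⟨_, ?_, rfl⟩
  rw [mem_sphere_zero_iff_norm, pi_norm_const]
  split_ifs <;> simp

theorem tgt_mem_cellFrontier (a : cell C 1 × Bool) : tgt a ∈ cellFrontier 1 a.1 := by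
  rw [← src_not]
  exact src_mem_cellFrontier (a.1, !a.2)

theorem cellFrontier_one_subset (x : cell C 1) : cellFrontier 1 x ⊆ range (vertexPt (C := C)) := by
  obtain ⟨v, v', h⟩ := CWComplex.exists_cellFrontier_one_eq x
  rw [h, closedCell_zero, closedCell_zero]
  rintro _ (rfl | rfl) <;> exact mem_range_self _

theorem src_mem_range (a : cell C 1 × Bool) : src a ∈ range (vertexPt (C := C)) :=
  cellFrontier_one_subset _ (src_mem_cellFrontier a)

theorem tgt_mem_range (a : cell C 1 × Bool) : tgt a ∈ range (vertexPt (C := C)) :=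
  cellFrontier_one_subset _ (tgt_mem_cellFrontier a)

theorem isEdgePath_append {w w' : List (cell C 1 × Bool)} {p q : X} :
    IsEdgePath (w ++ w') p q ↔ ∃ m, IsEdgePath w p m ∧ IsEdgePath w' m q := by
  induction w generalizing p with
  | nil => simp [IsEdgePath]
  | cons a w ih => simp [IsEdgePath, ih, and_assoc]

theorem isEdgePath_singleton (a : cell C 1 × Bool) : IsEdgePath [a] (src a) (tgt a) :=
  ⟨rfl, rfl⟩

theorem IsEdgePath.invRev {w : List (cell C 1 × Bool)} {p q : X} (h : IsEdgePath w p q) :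
    IsEdgePath (FreeGroup.invRev w) q p := by
  induction w generalizing p with
  | nil => exact h.symm
  | cons a w ih =>
    rw [FreeGroup.invRev_cons]
    refine isEdgePath_append.2 ⟨tgt a, ih h.2, ?_⟩
    have := isEdgePath_singleton (a.1, !a.2)
    rw [src_not, tgt_not] at this
    have ha := h.1
    subst ha
    exact this

theorem mem_invRev_iff {α : Type*} {w : List (α × Bool)} {a : α × Bool} :
    a ∈ FreeGroup.invRev w ↔ (a.1, !a.2) ∈ w := by
  simp only [FreeGroup.invRev, List.mem_reverse, List.mem_map]
  constructor
  · rintro ⟨b, hb, rfl⟩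
    simpa using hb
  · intro h
    exact ⟨_, h, by simp⟩

theorem forall_mem_invRev {α : Type*} {w : List (α × Bool)} {T : Set α}
    (h : ∀ a ∈ w, a.1 ∈ T) : ∀ a ∈ FreeGroup.invRev w, a.1 ∈ T :=
  fun a ha => h (a.1, !a.2) (mem_invRev_iff.1 ha)

theorem IsEdgePath.exists_src_eq {w : List (cell C 1 × Bool)} {p q : X} (h : IsEdgePath w p q)
    (hw : w ≠ []) : ∃ a ∈ w, src a = p := by
  cases w with
  | nil => exact absurd rfl hw
  | cons a w => exact ⟨a, by simp, h.1⟩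

theorem IsEdgePath.exists_tgt_eq {w : List (cell C 1 × Bool)} {p q : X} (h : IsEdgePath w p q)
    (hw : w ≠ []) : ∃ a ∈ w, tgt a = q := by
  obtain ⟨a, ha, h⟩ := h.invRev.exists_src_eq (by simpa [FreeGroup.invRev] using hw)
  exact ⟨_, mem_invRev_iff.1 ha, by rw [tgt_not]; exact h⟩

theorem IsEdgePath.rotate {w w' : List (cell C 1 × Bool)} {p : X}
    (h : IsEdgePath (w ++ w') p p) : ∃ q, IsEdgePath (w' ++ w) q q := by
  obtain ⟨q, h, h'⟩ := isEdgePath_append.1 h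
  exact ⟨q, isEdgePath_append.2 ⟨p, h', h⟩⟩

theorem IsEdgePath.exists_pred {w : List (cell C 1 × Bool)} {p : X} (h : IsEdgePath w p p)
    {a : cell C 1 × Bool} (ha : a ∈ w) : ∃ b ∈ w, tgt b = src a := by
  obtain ⟨s, t, rfl⟩ := List.append_of_mem ha
  obtain ⟨q, hq⟩ := h.rotate
  have : q = src a := hq.1.symm
  subst this
  obtain ⟨b, hb, h⟩ := hq.exists_tgt_eq (by simp)
  refine ⟨b, ?_, h⟩
  simp only [List.cons_append, List.mem_cons, List.mem_append] at hb ⊢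
  tauto

theorem IsEdgePath.exists_succ {w : List (cell C 1 × Bool)} {p : X} (h : IsEdgePath w p p)
    {a : cell C 1 × Bool} (ha : a ∈ w) : ∃ b ∈ w, src b = tgt a := by
  obtain ⟨b, hb, hab⟩ := h.invRev.exists_pred (a := (a.1, !a.2)) (mem_invRev_iff.2 (by simpa))
  exact ⟨_, mem_invRev_iff.1 hb, by rw [src_not, ← src_not a.1]; exact hab⟩

theorem IsEdgePath.tgt_getElem {w : List (cell C 1 × Bool)} {p q : X} (h : IsEdgePath w p q)
    (i : ℕ) (hi : i + 1 < w.length) : tgt w[i] = src w[i + 1] := by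
  induction w generalizing p i with
  | nil => simp at hi
  | cons a w ih =>
    cases i with
    | zero =>
      cases w with
      | nil => simp at hi
      | cons b w => exact h.2.1.symm
    | succ i => simpa using ih h.2 i (by simpa using hi)

/-! ### Simple closed edge paths -/

/-- A closed edge path that passes at most once through every 0-cell and every 1-cell. -/
structure IsSimpleCycle (w : List (cell C 1 × Bool)) : Prop where
  closed : ∃ p, IsEdgePath w p p
  nodup_src : (w.map src).Nodup
  nodup_tgt : (w.map tgt).Nodup
  nodup_fst : (w.map Prod.fst).Nodup

theorem IsSimpleCycle.rotate {w w' : List (cell C 1 × Bool)} (h : IsSimpleCycle (w ++ w')) :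
    IsSimpleCycle (w' ++ w) where
  closed := h.closed.choose_spec.rotate
  nodup_src := by
    rw [List.map_append, List.nodup_append_comm, ← List.map_append]
    exact h.nodup_src
  nodup_tgt := by
    rw [List.map_append, List.nodup_append_comm, ← List.map_append]
    exact h.nodup_tgt
  nodup_fst := by
    rw [List.map_append, List.nodup_append_comm, ← List.map_append]
    exact h.nodup_fst

theorem IsSimpleCycle.invRev {w : List (cell C 1 × Bool)} (h : IsSimpleCycle w) :
    IsSimpleCycle (FreeGroup.invRev w) where
  closed := h.closed.imp fun _ hp => hp.invRev
  nodup_src := by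
    rw [FreeGroup.invRev, List.map_reverse, List.nodup_reverse, List.map_map]
    simpa [Function.comp_def, src_not] using h.nodup_tgt
  nodup_tgt := by
    rw [FreeGroup.invRev, List.map_reverse, List.nodup_reverse, List.map_map]
    simpa [Function.comp_def, tgt_not] using h.nodup_src
  nodup_fst := by
    rw [FreeGroup.invRev, List.map_reverse, List.nodup_reverse, List.map_map]
    simpa [Function.comp_def] using h.nodup_fst

theorem eq_or_eq_not_of_fst_eq {α : Type*} {a b : α × Bool} (h : a.1 = b.1) :
    a = b ∨ a = (b.1, !b.2) := by
  obtain ⟨a, s⟩ := a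
  obtain ⟨b, t⟩ := b
  obtain rfl : a = b := h
  cases s <;> cases t <;> simp

/-- A simple closed edge path is determined by its first letter and its set of 1-cells: at the end of
a letter there is only one other 1-cell of the path to continue with. -/
theorem IsSimpleCycle.eq_of_head_eq {w w' : List (cell C 1 × Bool)} (h : IsSimpleCycle w)
    (h' : IsSimpleCycle w') (hww' : ∀ x, x ∈ w.map Prod.fst ↔ x ∈ w'.map Prod.fst)
    (hhead : w.head? = w'.head?) : w = w' := by
  have hlen : w.length = w'.length := by
    simpa using ((List.perm_ext_iff_of_nodup h.nodup_fst h'.nodup_fst).2 hww').length_eq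
  refine List.ext_getElem hlen fun i => ?_
  induction i with
  | zero =>
    intro hi hi'
    rw [List.head?_eq_getElem?, List.head?_eq_getElem?, List.getElem?_eq_getElem hi,
      List.getElem?_eq_getElem hi'] at hhead
    exact Option.some_injective _ hhead
  | succ i ih =>
    intro hi hi'
    have ih := ih (by omega) (by omega)
    obtain ⟨p, hp⟩ := h.closed
    obtain ⟨p', hp'⟩ := h'.closed
    obtain ⟨a, ha, hax⟩ := List.mem_map.1
      ((hww' w'[i + 1].1).2 (List.mem_map_of_mem (List.getElem_mem hi')))
    have e := hp.tgt_getElem i hi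
    have e' := hp'.tgt_getElem i hi'
    rcases eq_or_eq_not_of_fst_eq hax with rfl | rfl
    · refine List.inj_on_of_nodup_map h.nodup_src (List.getElem_mem hi) ha ?_
      rw [← e, ← e', ih]
    · exfalso
      have h₁ : w[i] = (w'[i + 1].1, !w'[i + 1].2) := by
        refine List.inj_on_of_nodup_map h.nodup_tgt (List.getElem_mem _) ha ?_
        rw [ih, tgt_not, e']
      have h₂ := h'.nodup_fst.getElem_inj_iff (i := i) (j := i + 1) (hi := by simp; omega)
        (hj := by simpa using hi')
      simp only [List.getElem_map, ← ih, h₁] at h₂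
      simp at h₂

theorem isConj_mk_append {α : Type*} (w w' : List (α × Bool)) :
    IsConj (FreeGroup.mk (w ++ w')) (FreeGroup.mk (w' ++ w)) := by
  refine isConj_iff.2 ⟨(FreeGroup.mk w)⁻¹, ?_⟩
  rw [← FreeGroup.mul_mk, ← FreeGroup.mul_mk]
  group

theorem IsSimpleCycle.isConj_of_mem {w w' : List (cell C 1 × Bool)} (h : IsSimpleCycle w)
    (h' : IsSimpleCycle w') (hww' : ∀ x, x ∈ w.map Prod.fst ↔ x ∈ w'.map Prod.fst)
    {a : cell C 1 × Bool} (ha : a ∈ w) (ha' : a ∈ w') :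
    IsConj (FreeGroup.mk w) (FreeGroup.mk w') := by
  obtain ⟨s, t, rfl⟩ := List.append_of_mem ha
  obtain ⟨s', t', rfl⟩ := List.append_of_mem ha'
  have := h.rotate.eq_of_head_eq h'.rotate (fun x => ?_) (by simp)
  · exact (isConj_mk_append _ _).trans (this ▸ isConj_mk_append _ _)
  · have := hww' x
    simp only [List.map_append, List.mem_append] at this ⊢
    tauto

/-- Simple closed edge paths through the same 1-cells agree up to rotation and inversion. -/
theorem IsSimpleCycle.isConj_or {w w' : List (cell C 1 × Bool)} (h : IsSimpleCycle w)
    (h' : IsSimpleCycle w') (hww' : ∀ x, x ∈ w.map Prod.fst ↔ x ∈ w'.map Prod.fst) :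
    IsConj (FreeGroup.mk w) (FreeGroup.mk w') ∨ IsConj (FreeGroup.mk w)⁻¹ (FreeGroup.mk w') := by
  cases w' with
  | nil =>
    obtain rfl : w = [] := by
      cases w with
      | nil => rfl
      | cons b w => simpa using hww' b.1
    exact Or.inl (IsConj.refl _)
  | cons a w' =>
    obtain ⟨b, hb, hba⟩ := List.mem_map.1 ((hww' a.1).2 (by simp))
    rcases eq_or_eq_not_of_fst_eq hba with rfl | rfl
    · exact Or.inl (h.isConj_of_mem h' hww' hb (by simp))
    · refine Or.inr ?_
      rw [FreeGroup.inv_mk]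
      refine h.invRev.isConj_of_mem h' (fun x => ?_) (mem_invRev_iff.2 hb) (by simp)
      rw [← hww' x]
      simp [FreeGroup.invRev]

/-! ### Spanning trees -/

theorem exists_append_of_not_nodup_map {α β : Type*} (f : α → β) (w : List α)
    (h : ¬ (w.map f).Nodup) : ∃ s a t b r, w = s ++ a :: (t ++ b :: r) ∧ f a = f b := by
  induction w with
  | nil => simp at h
  | cons a w ih =>
    by_cases ha : f a ∈ w.map f
    · obtain ⟨b, hb, hab⟩ := List.mem_map.1 ha
      obtain ⟨t, r, rfl⟩ := List.append_of_mem hb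
      exact ⟨[], a, t, b, r, rfl, hab.symm⟩
    · obtain ⟨s, c, t, b, r, rfl, hcb⟩ := ih fun H => h (by
        rw [List.map_cons, List.nodup_cons]
        exact ⟨ha, H⟩)
      exact ⟨a :: s, c, t, b, r, rfl, hcb⟩

/-- A closed edge path in a tree is trivial in the free group on the 1-cells: a 1-cell that is
repeated splits it into shorter closed edge paths. -/
theorem IsSpanningTree.mk_eq_one {T : Set (cell C 1)} (hT : IsSpanningTree T)
    (w : List (cell C 1 × Bool)) (p : X) (hw : ∀ a ∈ w, a.1 ∈ T) (hp : IsEdgePath w p p) :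
    FreeGroup.mk w = 1 := by
  induction hn : w.length using Nat.strong_induction_on generalizing w p with
  | _ n ih =>
  subst hn
  by_cases hnil : w = []
  · subst hnil
    rfl
  obtain ⟨s, a, t, b, r, rfl, hab⟩ := exists_append_of_not_nodup_map Prod.fst w
    fun H => hT.acyclic w p hnil hw H hp
  obtain ⟨q, hs, rfl, htr⟩ := isEdgePath_append.1 hp
  obtain ⟨q', ht, rfl, hr⟩ := isEdgePath_append.1 htr
  simp only [List.mem_append, List.mem_cons] at hw
  rcases eq_or_eq_not_of_fst_eq hab.symm with rfl | rfl
  · have h₁ := ih (b :: t).length (by simp; omega) (b :: t) (src b)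
      (fun c hc => hw c (by simp only [List.mem_cons] at hc; tauto)) ⟨rfl, ht⟩ rfl
    have h₂ := ih (s ++ b :: r).length (by simp) (s ++ b :: r) p
      (fun c hc => hw c (by simp only [List.mem_append, List.mem_cons] at hc; tauto))
      (isEdgePath_append.2 ⟨_, hs, rfl, hr⟩) rfl
    rw [← List.cons_append, ← FreeGroup.mul_mk, ← FreeGroup.mul_mk, h₁, one_mul,
      FreeGroup.mul_mk, h₂]
  · rw [src_not] at ht
    rw [tgt_not] at hr
    have h₁ := ih t.length (by simp; omega) t (tgt a) (fun c hc => hw c (by tauto)) ht rfl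
    have h₂ := ih (s ++ r).length (by simp; omega) (s ++ r) p
      (fun c hc => hw c (by simp only [List.mem_append] at hc; tauto))
      (isEdgePath_append.2 ⟨_, hs, hr⟩) rfl
    have h₃ : FreeGroup.mk [(a.1, !a.2)] = (FreeGroup.mk [a])⁻¹ := by
      simp [FreeGroup.inv_mk, FreeGroup.invRev]
    rw [← List.singleton_append, ← List.singleton_append (l := r), ← FreeGroup.mul_mk,
      ← FreeGroup.mul_mk, ← FreeGroup.mul_mk, ← FreeGroup.mul_mk, h₁, one_mul, h₃,
      mul_inv_cancel_left, FreeGroup.mul_mk, h₂]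

open Classical in
/-- The homomorphism of free groups that kills the 1-cells in `T`. -/
noncomputable def collapse (T : Set (cell C 1)) :
    FreeGroup (cell C 1) →* FreeGroup {x : cell C 1 // x ∉ T} :=
  FreeGroup.lift fun x => if h : x ∈ T then 1 else FreeGroup.of ⟨x, h⟩

theorem collapse_of_mem {T : Set (cell C 1)} {x : cell C 1} (h : x ∈ T) :
    collapse T (FreeGroup.of x) = 1 := by
  simp [collapse, h]

theorem collapse_of_notMem {T : Set (cell C 1)} {x : cell C 1} (h : x ∉ T) :
    collapse T (FreeGroup.of x) = FreeGroup.of ⟨x, h⟩ := by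
  simp [collapse, h]

theorem mk_singleton {α : Type*} (a : α × Bool) :
    FreeGroup.mk [a] = cond a.2 (FreeGroup.of a.1) (FreeGroup.of a.1)⁻¹ := by
  obtain ⟨x, _ | _⟩ := a <;> simp [FreeGroup.of, FreeGroup.inv_mk, FreeGroup.invRev]

theorem mk_cons {α : Type*} (a : α × Bool) (w : List (α × Bool)) :
    FreeGroup.mk (a :: w) = FreeGroup.mk [a] * FreeGroup.mk w := by
  rw [FreeGroup.mul_mk, List.singleton_append]

theorem mk_deleteTree (T : Set (cell C 1)) (w : List (cell C 1 × Bool)) :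
    FreeGroup.mk (deleteTree T w) = collapse T (FreeGroup.mk w) := by
  induction w with
  | nil => exact (map_one _).symm
  | cons a w ih =>
    rw [mk_cons, map_mul, ← ih, mk_singleton]
    by_cases h : a.1 ∈ T
    · have h₁ : deleteTree T (a :: w) = deleteTree T w := by simp [deleteTree, h]
      rw [h₁]
      obtain ⟨x, _ | _⟩ := a <;> simp [collapse_of_mem h]
    · have h₁ : deleteTree T (a :: w) = (⟨a.1, h⟩, a.2) :: deleteTree T w := by
        simp [deleteTree, h]
      rw [h₁, mk_cons, mk_singleton]
      obtain ⟨x, _ | _⟩ := a <;> simp [collapse_of_notMem h]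

theorem collapse_mk_eq_one {T : Set (cell C 1)} {w : List (cell C 1 × Bool)}
    (hw : ∀ a ∈ w, a.1 ∈ T) : collapse T (FreeGroup.mk w) = 1 := by
  induction w with
  | nil => exact map_one _
  | cons a w ih =>
    rw [mk_cons, map_mul, ih fun b hb => hw b (List.mem_cons_of_mem _ hb), mk_singleton]
    have := hw a (by simp)
    obtain ⟨x, _ | _⟩ := a <;> simp [collapse_of_mem this]

/-- `g` labels every 0-cell `p` by the word of an edge path in `T` from the base point `p₀` to `p`,
and these labels are compatible with the 1-cells of `T`. The values of `g` at points that are not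
0-cells are irrelevant. -/
structure IsTreePotential (T : Set (cell C 1)) (p₀ : X) (g : X → FreeGroup (cell C 1)) : Prop where
  base : g p₀ = 1
  exists_path : ∀ p ∈ range (vertexPt (C := C)), ∃ w : List (cell C 1 × Bool),
    (∀ a ∈ w, a.1 ∈ T) ∧ IsEdgePath w p₀ p ∧ g p = FreeGroup.mk w
  mul_mk : ∀ a : cell C 1 × Bool, a.1 ∈ T → g (src a) * FreeGroup.mk [a] = g (tgt a)

theorem IsSpanningTree.exists_isTreePotential {T : Set (cell C 1)} (hT : IsSpanningTree T)
    (v₀ : cell C 0) : ∃ g, IsTreePotential T (vertexPt v₀) g := by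
  have : ∀ p : X, ∃ w : List (cell C 1 × Bool), p ∈ range (vertexPt (C := C)) →
      (∀ a ∈ w, a.1 ∈ T) ∧ IsEdgePath w (vertexPt v₀) p := by
    intro p
    by_cases hp : p ∈ range (vertexPt (C := C))
    · obtain ⟨v, rfl⟩ := hp
      exact (hT.connected v₀ v).imp fun w hw _ => hw
    · exact ⟨[], fun h => absurd h hp⟩
  choose τ hτ using this
  refine ⟨fun p => FreeGroup.mk (τ p), ⟨?_, fun p hp => ⟨τ p, (hτ p hp).1, (hτ p hp).2, rfl⟩,
    fun a ha => ?_⟩⟩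
  · have := hτ _ (mem_range_self v₀)
    exact hT.mk_eq_one _ _ this.1 this.2
  · obtain ⟨h₁, h₂⟩ := hτ _ (src_mem_range a)
    obtain ⟨h₃, h₄⟩ := hτ _ (tgt_mem_range a)
    have := hT.mk_eq_one (τ (src a) ++ ([a] ++ FreeGroup.invRev (τ (tgt a)))) (vertexPt v₀)
      (by
        intro b hb
        rcases List.mem_append.1 hb with hb | hb
        · exact h₁ b hb
        rcases List.mem_append.1 hb with hb | hb
        · rw [List.mem_singleton.1 hb]
          exact ha
        · exact forall_mem_invRev h₃ b hb)
      (isEdgePath_append.2 ⟨_, h₂, isEdgePath_append.2 ⟨_, isEdgePath_singleton a, h₄.invRev⟩⟩)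
    rw [← FreeGroup.mul_mk, ← FreeGroup.mul_mk, ← FreeGroup.inv_mk, ← mul_assoc,
      mul_inv_eq_one] at this
    exact this

/-- The homomorphism that carries a generator `x` not in the tree labelled by `g` to the closed edge
path that runs in this tree from the base point to the initial point of `x`, along `x`, and back,
read off after collapsing `T'`. -/
noncomputable def treeChange (T T' : Set (cell C 1)) (g : X → FreeGroup (cell C 1)) :
    FreeGroup {x : cell C 1 // x ∉ T} →* FreeGroup {x : cell C 1 // x ∉ T'} :=
  FreeGroup.lift fun x =>
    collapse T' (g (src (x.1, true)) * FreeGroup.of x.1 * (g (tgt (x.1, true)))⁻¹)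

theorem IsTreePotential.treeChange_collapse {T : Set (cell C 1)} {p₀ : X}
    {g : X → FreeGroup (cell C 1)} (hg : IsTreePotential T p₀ g) (T' : Set (cell C 1))
    {w : List (cell C 1 × Bool)} {p q : X} (hw : IsEdgePath w p q) :
    treeChange T T' g (collapse T (FreeGroup.mk w)) =
      collapse T' (g p * FreeGroup.mk w * (g q)⁻¹) := by
  have key : ∀ a : cell C 1 × Bool, treeChange T T' g (collapse T (FreeGroup.mk [a])) =
      collapse T' (g (src a) * FreeGroup.mk [a] * (g (tgt a))⁻¹) := by
    intro a
    by_cases h : a.1 ∈ T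
    · rw [hg.mul_mk a h, collapse_mk_eq_one (by simpa using h)]
      simp
    · have hx : treeChange T T' g (FreeGroup.of ⟨a.1, h⟩) = collapse T' (g (src (a.1, true)) *
          FreeGroup.of a.1 * (g (tgt (a.1, true)))⁻¹) := by
        simp [treeChange]
      obtain ⟨x, _ | _⟩ := a
      · rw [mk_singleton]
        simp only [cond_false, map_inv, collapse_of_notMem h]
        rw [hx, ← map_inv, ← src_not x false, ← tgt_not x false]
        simp [mul_assoc]
      · rw [mk_singleton]
        simp only [cond_true, collapse_of_notMem h]
        exact hx
  induction w generalizing p with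
  | nil =>
    obtain rfl : p = q := hw
    rw [← FreeGroup.one_eq_mk]
    simp
  | cons a w ih =>
    obtain ⟨rfl, hw⟩ := hw
    rw [mk_cons, map_mul, map_mul, ih hw, key a, ← map_mul]
    congr 1
    group

theorem IsTreePotential.treeChange_comp {T T' : Set (cell C 1)} {p₀ : X}
    {g g' : X → FreeGroup (cell C 1)} (hg : IsTreePotential T p₀ g)
    (hg' : IsTreePotential T' p₀ g') :
    (treeChange T' T g').comp (treeChange T T' g) = MonoidHom.id _ := by
  ext x
  obtain ⟨w₁, hw₁, hp₁, hgw₁⟩ := hg.exists_path _ (src_mem_range (x.1, true))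
  obtain ⟨w₂, hw₂, hp₂, hgw₂⟩ := hg.exists_path _ (tgt_mem_range (x.1, true))
  have hw : IsEdgePath (w₁ ++ ([(x.1, true)] ++ FreeGroup.invRev w₂)) p₀ p₀ :=
    isEdgePath_append.2 ⟨_, hp₁, isEdgePath_append.2 ⟨_, isEdgePath_singleton _, hp₂.invRev⟩⟩
  have h₁ : treeChange T T' g (FreeGroup.of x) =
      collapse T' (FreeGroup.mk (w₁ ++ ([(x.1, true)] ++ FreeGroup.invRev w₂))) := by
    rw [treeChange, FreeGroup.lift_apply_of, hgw₁, hgw₂, ← FreeGroup.mul_mk, ← FreeGroup.mul_mk,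
      FreeGroup.inv_mk, mul_assoc]
    rfl
  rw [MonoidHom.comp_apply, h₁, hg'.treeChange_collapse T hw, hg'.base, one_mul, inv_one, mul_one,
    ← FreeGroup.mul_mk, ← FreeGroup.mul_mk, map_mul, map_mul, collapse_mk_eq_one hw₁,
    collapse_mk_eq_one (forall_mem_invRev hw₂), one_mul, mul_one]
  exact collapse_of_notMem x.2

/-- The standard presentation does not depend on the spanning tree, nor on the choice of boundary
words up to conjugation and inversion. -/
theorem IsSpanningTree.qEquiv_standardPres [CWComplex.Finite C] {T T' : Set (cell C 1)}
    (hT : IsSpanningTree T) (hT' : IsSpanningTree T') {b b' : cell C 2 → List (cell C 1 × Bool)}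
    (hb : ∀ e, ∃ p, IsEdgePath (b e) p p)
    (hbb' : ∀ e, IsConj (FreeGroup.mk (b e)) (FreeGroup.mk (b' e)) ∨
      IsConj (FreeGroup.mk (b e))⁻¹ (FreeGroup.mk (b' e))) :
    GroupPres.QEquiv (standardPres T b) (standardPres T' b') := by
  obtain ⟨v₀⟩ := hT.nonempty
  obtain ⟨g, hg⟩ := hT.exists_isTreePotential v₀
  obtain ⟨g', hg'⟩ := hT'.exists_isTreePotential v₀
  refine GroupPres.qEquiv_of_mulEquiv (standardPres T b) (standardPres T' b')
    ((treeChange T T' g).toMulEquiv (treeChange T' T g') (hg.treeChange_comp hg')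
      (hg'.treeChange_comp hg)) (Equiv.refl _) fun e => ?_
  change IsConj (treeChange T T' g (FreeGroup.mk (deleteTree T (b e))))
      (FreeGroup.mk (deleteTree T' (b' e))) ∨
    IsConj (treeChange T T' g (FreeGroup.mk (deleteTree T (b e))))⁻¹
      (FreeGroup.mk (deleteTree T' (b' e)))
  obtain ⟨p, hp⟩ := hb e
  rw [mk_deleteTree, mk_deleteTree, hg.treeChange_collapse T' hp, ← map_inv]
  refine (hbb' e).imp (fun h => (collapse T').map_isConj ?_) fun h => (collapse T').map_isConj ?_
  · exact (isConj_iff.2 ⟨g p, rfl⟩ : IsConj (FreeGroup.mk (b e)) _).symm.trans h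
  · refine (isConj_iff.2 ⟨g p, ?_⟩ : IsConj (FreeGroup.mk (b e))⁻¹ _).symm.trans h
    group

/-- A set of 1-cells is a spanning tree if exactly one of its 1-cells leads down from each 0-cell
other than `root`, for some height function that is not constant on any of its 1-cells: a highest
0-cell on a closed edge path would be left and reached by the same 1-cell. -/
theorem isSpanningTree_of_height {T : Set (cell C 1)} (root : cell C 0) (ht : X → ℕ)
    (hdown : ∀ v, v ≠ root → ∃ a : cell C 1 × Bool, a.1 ∈ T ∧ src a = vertexPt v ∧
      ht (tgt a) < ht (src a))
    (hne : ∀ a : cell C 1 × Bool, a.1 ∈ T → ht (src a) ≠ ht (tgt a))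
    (huniq : ∀ a b : cell C 1 × Bool, a.1 ∈ T → b.1 ∈ T → src a = src b →
      ht (tgt a) < ht (src a) → ht (tgt b) < ht (src b) → a.1 = b.1) : IsSpanningTree T where
  nonempty := ⟨root⟩
  connected := by
    have key : ∀ v : cell C 0, ∃ w : List (cell C 1 × Bool),
        (∀ a ∈ w, a.1 ∈ T) ∧ IsEdgePath w (vertexPt v) (vertexPt root) := by
      intro v
      induction hn : ht (vertexPt v) using Nat.strong_induction_on generalizing v with
      | _ n ih =>
      by_cases hv : v = root
      · exact ⟨[], by simp, by rw [hv]; rfl⟩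
      · obtain ⟨a, h₁, h₂, h₃⟩ := hdown v hv
        obtain ⟨v', hv'⟩ := tgt_mem_range a
        obtain ⟨w, hw, hp⟩ := ih _ (by rw [← hn, ← h₂, hv']; exact h₃) v' rfl
        refine ⟨a :: w, ?_, h₂, by rw [← hv']; exact hp⟩
        exact List.forall_mem_cons.2 ⟨h₁, hw⟩
    intro v v'
    obtain ⟨w, hw, hp⟩ := key v
    obtain ⟨w', hw', hp'⟩ := key v'
    refine ⟨w ++ FreeGroup.invRev w', fun a ha => ?_, isEdgePath_append.2 ⟨_, hp, hp'.invRev⟩⟩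
    exact (List.mem_append.1 ha).elim (hw a) (forall_mem_invRev hw' a)
  acyclic := by
    intro w p hnil hw hnodup hp
    obtain ⟨a, ha, hmax⟩ := Set.exists_max_image {a | a ∈ w} (fun a => ht (src a))
      (List.finite_toSet w) (List.exists_mem_of_ne_nil w hnil)
    obtain ⟨b, hb, hba⟩ := hp.exists_pred ha
    obtain ⟨c, hc, hca⟩ := hp.exists_succ ha
    have h₁ : ht (tgt a) < ht (src a) :=
      lt_of_le_of_ne (hca ▸ hmax c hc) (hne a (hw a ha)).symm
    have h₂ : ht (src b) < ht (tgt b) :=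
      lt_of_le_of_ne (hba ▸ hmax b hb) (hne b (hw b hb))
    have hab := huniq a (b.1, !b.2) (hw a ha) (hw b hb) (by rw [src_not]; exact hba.symm) h₁
      (by rw [src_not, tgt_not]; exact h₂)
    obtain rfl : a = b := List.inj_on_of_nodup_map hnodup ha hb hab
    exact hne a (hw a ha) (by rw [hba])

/-! ### Parametrizing the boundary of the square -/

/-- The point of the unit sphere of the sup norm on `ℝ²` in the direction of angle `2πs`. -/
noncomputable def squareParam (s : ℝ) : Fin 2 → ℝ :=
  ‖![Real.cos (2 * Real.pi * s), Real.sin (2 * Real.pi * s)]‖⁻¹ •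
    ![Real.cos (2 * Real.pi * s), Real.sin (2 * Real.pi * s)]

theorem norm_cos_sin_pos (θ : ℝ) : 0 < ‖![Real.cos θ, Real.sin θ]‖ := by
  rw [norm_pos_iff]
  intro h
  have h₀ := congrFun h 0
  have h₁ := congrFun h 1
  simp only [Matrix.cons_val_zero, Matrix.cons_val_one, Pi.zero_apply] at h₀ h₁
  have := Real.sin_sq_add_cos_sq θ
  rw [h₀, h₁] at this
  norm_num at this

theorem continuous_squareParam : Continuous squareParam := by
  have h : Continuous fun s : ℝ =>
      ![Real.cos (2 * Real.pi * s), Real.sin (2 * Real.pi * s)] := by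
    refine continuous_pi fun i => ?_
    fin_cases i
    · simp only [Fin.zero_eta, Matrix.cons_val_zero]
      fun_prop
    · simp only [Fin.mk_one, Matrix.cons_val_one]
      fun_prop
  exact (h.norm.inv₀ fun s => (norm_cos_sin_pos _).ne').smul h

theorem norm_squareParam (s : ℝ) : ‖squareParam s‖ = 1 := by
  rw [squareParam, norm_smul, norm_inv, norm_norm, inv_mul_cancel₀ (norm_cos_sin_pos _).ne']

theorem squareParam_eq_iff {s t : ℝ} : squareParam s = squareParam t ↔ ∃ k : ℤ, s = t + k := by
  constructor
  · intro h
    set a := 2 * Real.pi * s with ha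
    set b := 2 * Real.pi * t with hb
    obtain ⟨c, hc, hcos, hsin⟩ : ∃ c : ℝ, 0 < c ∧ Real.cos a = c * Real.cos b ∧
        Real.sin a = c * Real.sin b := by
      have hA := norm_cos_sin_pos a
      have hB := norm_cos_sin_pos b
      rw [squareParam, squareParam, ← ha, ← hb] at h
      set A := ‖![Real.cos a, Real.sin a]‖
      set B := ‖![Real.cos b, Real.sin b]‖
      have h₀ := congrFun h 0
      have h₁ := congrFun h 1
      simp only [Pi.smul_apply, Matrix.cons_val_zero, Matrix.cons_val_one, smul_eq_mul] at h₀ h₁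
      refine ⟨A * B⁻¹, by positivity, ?_, ?_⟩
      · rw [mul_assoc, ← h₀, mul_inv_cancel_left₀ hA.ne']
      · rw [mul_assoc, ← h₁, mul_inv_cancel_left₀ hA.ne']
    have hc1 : c = 1 := by
      have h₁ := Real.sin_sq_add_cos_sq a
      have h₂ := Real.sin_sq_add_cos_sq b
      rw [hcos, hsin] at h₁
      have : c ^ 2 = 1 := by linear_combination h₁ - c ^ 2 * h₂
      nlinarith
    rw [hc1, one_mul] at hcos hsin
    obtain ⟨k, hk⟩ := Real.Angle.angle_eq_iff_two_pi_dvd_sub.1 (Real.Angle.cos_sin_inj hcos hsin)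
    refine ⟨k, ?_⟩
    have hπ : (2 * Real.pi) ≠ 0 := by positivity
    apply mul_left_cancel₀ hπ
    rw [ha, hb] at hk
    linear_combination hk
  · rintro ⟨k, rfl⟩
    have : 2 * Real.pi * (t + k) = 2 * Real.pi * t + k * (2 * Real.pi) := by ring
    rw [squareParam, squareParam, this, Real.cos_add_int_mul_two_pi, Real.sin_add_int_mul_two_pi]

theorem exists_squareParam_eq {z : Fin 2 → ℝ} (hz : ‖z‖ = 1) : ∃ s, squareParam s = z := by
  set ζ : ℂ := ⟨z 0, z 1⟩ with hζ
  have hζ0 : ζ ≠ 0 := by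
    intro h
    have h₀ : z 0 = 0 := congrArg Complex.re h
    have h₁ : z 1 = 0 := congrArg Complex.im h
    have : z = 0 := by
      ext i
      fin_cases i
      · exact h₀
      · exact h₁
    rw [this, norm_zero] at hz
    exact zero_ne_one hz
  have hpos : 0 < ‖ζ‖ := norm_pos_iff.2 hζ0
  refine ⟨ζ.arg / (2 * Real.pi), ?_⟩
  have hπ : 2 * Real.pi * (ζ.arg / (2 * Real.pi)) = ζ.arg := by
    have : Real.pi ≠ 0 := Real.pi_ne_zero
    field_simp
  have hv : ![Real.cos ζ.arg, Real.sin ζ.arg] = ‖ζ‖⁻¹ • z := by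
    rw [Complex.cos_arg hζ0, Complex.sin_arg]
    ext i
    fin_cases i
    · simp [hζ, div_eq_inv_mul]
    · simp [hζ, div_eq_inv_mul]
  rw [squareParam, hπ, hv, norm_smul, hz, norm_inv, norm_norm, mul_one, inv_inv, smul_smul,
    mul_inv_cancel₀ hpos.ne', one_smul]

theorem injOn_squareParam_add (s₀ : ℝ) : InjOn (fun s => squareParam (s₀ + s)) (Ico 0 1) := by
  intro s hs t ht h
  obtain ⟨k, hk⟩ := squareParam_eq_iff.1 h
  have hk' : s - t = k := by linarith
  have h₁ : (k : ℝ) < 1 := by linarith [hs.2, ht.1]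
  have h₂ : (-1 : ℝ) < k := by linarith [hs.1, ht.2]
  have : k = 0 := by
    have h₁ : k < 1 := by exact_mod_cast h₁
    have h₂ : -1 < k := by exact_mod_cast h₂
    omega
  rw [this] at hk'
  push_cast at hk'
  linarith

theorem squareParam_add_image (s₀ : ℝ) :
    (fun s => squareParam (s₀ + s)) '' Icc 0 1 = sphere 0 1 := by
  ext z
  rw [mem_sphere_zero_iff_norm]
  constructor
  · rintro ⟨s, -, rfl⟩
    exact norm_squareParam _
  · intro hz
    obtain ⟨s, rfl⟩ := exists_squareParam_eq hz
    refine ⟨Int.fract (s - s₀), ⟨Int.fract_nonneg _, (Int.fract_lt_one _).le⟩,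
      squareParam_eq_iff.2 ⟨-⌊s - s₀⌋, ?_⟩⟩
    rw [← Int.self_sub_floor]
    push_cast
    ring

/-! ### Subdivisions of an interval -/

theorem ne_of_continuousOn_of_injOn_Ioo {k : ℝ → ℝ} {a b : ℝ} (hab : a < b)
    (hk : ContinuousOn k (Icc a b)) (hinj : InjOn k (Ioo a b)) : k a ≠ k b := by
  intro h
  obtain ⟨c, hc, hca⟩ : ∃ c ∈ Ioo a b, k c ≠ k a := by
    by_contra! H
    obtain ⟨c, hac, hcb⟩ := exists_between hab
    obtain ⟨d, hcd, hdb⟩ := exists_between hcb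
    exact hcd.ne (hinj ⟨hac, hcb⟩ ⟨hac.trans hcd, hdb⟩
      ((H c ⟨hac, hcb⟩).trans (H d ⟨hac.trans hcd, hdb⟩).symm))
  have h₁ : ContinuousOn k (Icc a c) := hk.mono (Icc_subset_Icc_right hc.2.le)
  have h₂ : ContinuousOn k (Icc c b) := hk.mono (Icc_subset_Icc_left hc.1.le)
  -- a value strictly between `k a = k b` and `k c` is taken on both sides of `c`
  obtain ⟨y, hy₁, hy₂⟩ : ∃ y, y ∈ k '' Ioo a c ∧ y ∈ k '' Ioo c b := by
    rcases lt_or_gt_of_ne hca with hlt | hlt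
    · obtain ⟨y, hy⟩ := exists_between hlt
      exact ⟨y, intermediate_value_Ioo' hc.1.le h₁ hy, intermediate_value_Ioo hc.2.le h₂ (h ▸ hy)⟩
    · obtain ⟨y, hy⟩ := exists_between hlt
      exact ⟨y, intermediate_value_Ioo hc.1.le h₁ hy, intermediate_value_Ioo' hc.2.le h₂ (h ▸ hy)⟩
  obtain ⟨s, hs, rfl⟩ := hy₁
  obtain ⟨t, ht, hst⟩ := hy₂
  have := hinj ⟨hc.1.trans ht.1, ht.2⟩ ⟨hs.1, hs.2.trans hc.2⟩ hst
  exact absurd (hs.2.trans ht.1) (this ▸ lt_irrefl _)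

theorem exists_subdivision (Z : Finset ℝ) (h₀ : 0 ∈ Z) (h₁ : 1 ∈ Z) (hZ : ∀ z ∈ Z, z ∈ Icc 0 1) :
    ∃ (n : ℕ) (t : ℕ → ℝ), t 0 = 0 ∧ t n = 1 ∧ (∀ i < n, t i < t (i + 1)) ∧ (∀ i ≤ n, t i ∈ Z) ∧
      ∀ i < n, ∀ z ∈ Z, z ∉ Ioo (t i) (t (i + 1)) := by
  obtain ⟨n, hn⟩ : ∃ n, Z.card = n + 1 :=
    Nat.exists_eq_succ_of_ne_zero (Finset.card_ne_zero_of_mem h₀)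
  have ht : ∀ i (hi : i < n + 1),
      (fun i => if h : i < n + 1 then Z.orderEmbOfFin hn ⟨i, h⟩ else 0) i =
        Z.orderEmbOfFin hn ⟨i, hi⟩ := fun i hi => dif_pos hi
  refine ⟨n, fun i => if h : i < n + 1 then Z.orderEmbOfFin hn ⟨i, h⟩ else 0, ?_, ?_, ?_, ?_, ?_⟩
  · rw [ht 0 (by omega), Finset.orderEmbOfFin_zero hn (by omega)]
    exact le_antisymm (Finset.min'_le _ _ h₀) (Finset.le_min' _ _ _ fun z hz => (hZ z hz).1)
  · rw [ht n (by omega)]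
    have := Finset.orderEmbOfFin_last hn (by omega)
    simp only [Nat.add_sub_cancel] at this
    rw [this]
    exact le_antisymm (Finset.max'_le _ _ _ fun z hz => (hZ z hz).2) (Finset.le_max' _ _ h₁)
  · intro i hi
    rw [ht i (by omega), ht (i + 1) (by omega)]
    exact (Z.orderEmbOfFin hn).strictMono (by simp)
  · intro i hi
    rw [ht i (by omega)]
    exact Finset.orderEmbOfFin_mem _ _ _
  · intro i hi z hz
    rw [ht i (by omega), ht (i + 1) (by omega)]
    obtain ⟨⟨j, hj⟩, rfl⟩ : z ∈ range (Z.orderEmbOfFin hn) := by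
      rw [Finset.range_orderEmbOfFin]
      exact hz
    rintro ⟨h, h'⟩
    have h := (Z.orderEmbOfFin hn).lt_iff_lt.1 h
    have h' := (Z.orderEmbOfFin hn).lt_iff_lt.1 h'
    simp only [Fin.mk_lt_mk] at h h'
    omega

theorem lt_of_forall_lt_succ {t : ℕ → ℝ} {n : ℕ} (h : ∀ i < n, t i < t (i + 1)) {i j : ℕ}
    (hij : i < j) (hj : j ≤ n) : t i < t j := by
  induction j with
  | zero => omega
  | succ j ih =>
    rcases Nat.lt_succ_iff_lt_or_eq.1 hij with h' | rfl
    · exact (ih h' (by omega)).trans (h j (by omega))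
    · exact h i (by omega)

theorem exists_mem_Icc_of_subdivision {t : ℕ → ℝ} {n : ℕ} (hn : 0 < n) {s : ℝ}
    (hs : s ∈ Icc (t 0) (t n)) : ∃ i < n, s ∈ Icc (t i) (t (i + 1)) := by
  induction n with
  | zero => omega
  | succ n ih =>
    rcases le_total (t n) s with h | h
    · exact ⟨n, by omega, h, hs.2⟩
    · rcases Nat.eq_zero_or_pos n with rfl | hn
      · exact ⟨0, by omega, hs⟩
      · obtain ⟨i, hi, h⟩ := ih hn ⟨hs.1, h⟩
        exact ⟨i, by omega, h⟩

/-! ### Arcs in the 1-skeleton -/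

theorem IsRegular.injOn (hreg : IsRegular C) {n : ℕ} (i : cell C n) :
    InjOn (map n i) (closedBall 0 1) := by
  intro x hx y hy h
  exact congrArg Subtype.val ((hreg n i).injective (a₁ := ⟨x, hx⟩) (a₂ := ⟨y, hy⟩) h)

theorem IsRegular.src_ne_tgt (hreg : IsRegular C) (a : cell C 1 × Bool) : src a ≠ tgt a := by
  have hmem : ∀ s : Bool, (fun _ => if s then -1 else 1) ∈ closedBall (0 : Fin 1 → ℝ) 1 ∧
      (fun _ => if s then 1 else -1) ∈ closedBall (0 : Fin 1 → ℝ) 1 := by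
    intro s
    simp only [mem_closedBall_zero_iff, pi_norm_const]
    cases s <;> simp
  intro h
  have := congrFun (hreg.injOn a.1 (hmem a.2).1 (hmem a.2).2 h) 0
  cases ha : a.2 <;> norm_num [ha] at this

theorem eq_of_mem_openCell {n m : ℕ} {i : cell C n} {j : cell C m} {p : X}
    (hi : p ∈ openCell n i) (hj : p ∈ openCell m j) : (⟨n, i⟩ : Cells C) = ⟨m, j⟩ :=
  RelCWComplex.eq_of_not_disjoint_openCell (Set.not_disjoint_iff.2 ⟨p, hi, hj⟩)

theorem notMem_openCell_of_mem_range {n : ℕ} (hn : n ≠ 0) (i : cell C n) {p : X}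
    (hp : p ∈ range (vertexPt (C := C))) : p ∉ openCell n i := by
  obtain ⟨v, rfl⟩ := hp
  intro h
  have hv : vertexPt v ∈ openCell 0 v := by
    rw [openCell_zero]
    rfl
  exact hn (congrArg Sigma.fst (eq_of_mem_openCell h hv))

theorem mem_of_mem_closedCell_one {x : cell C 1} {p : X} (hp : p ∈ closedCell 1 x) :
    p ∈ openCell 1 x ∨ p ∈ range (vertexPt (C := C)) := by
  rw [← RelCWComplex.cellFrontier_union_openCell_eq_closedCell] at hp
  exact hp.symm.imp id fun h => cellFrontier_one_subset x h

theorem exists_src_eq_of_mem_cellFrontier {x : cell C 1} {p : X} (hp : p ∈ cellFrontier 1 x) :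
    ∃ s, src (x, s) = p := by
  rw [RelCWComplex.cellFrontier_one_eq] at hp
  obtain ⟨z, rfl | rfl, rfl⟩ := hp
  · exact ⟨true, rfl⟩
  · exact ⟨false, rfl⟩

theorem cellFrontier_two_subset (e : cell C 2) :
    cellFrontier 2 e ⊆ range (vertexPt (C := C)) ∪ ⋃ x : cell C 1, openCell 1 x := by
  obtain ⟨I, hI⟩ := CWComplex.cellFrontier_subset_finite_openCell 2 e
  intro p hp
  obtain ⟨m, hm, j, -, hp⟩ : ∃ m, ∃ _ : m < 2, ∃ j, ∃ _ : j ∈ I m, p ∈ openCell m j := by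
    simpa only [mem_iUnion] using hI hp
  obtain rfl | rfl : m = 0 ∨ m = 1 := by omega
  · rw [openCell_zero] at hp
    exact Or.inl ⟨j, hp.symm⟩
  · exact Or.inr (mem_iUnion.2 ⟨j, hp⟩)

/-- A path in a closed 1-cell of a regular complex has a continuous coordinate. -/
theorem IsRegular.exists_coord (hreg : IsRegular C) (x : cell C 1) {φ : ℝ → X} {S : Set ℝ}
    (hφ : ContinuousOn φ S) (hS : MapsTo φ S (closedCell 1 x)) :
    ∃ k : ℝ → ℝ, ContinuousOn k S ∧
      ∀ s ∈ S, ‖fun _ : Fin 1 => k s‖ ≤ 1 ∧ map 1 x (fun _ => k s) = φ s := by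
  have : ∀ s, ∃ z : closedBall (0 : Fin 1 → ℝ) 1, s ∈ S → map 1 x z.1 = φ s := by
    intro s
    by_cases hs : s ∈ S
    · obtain ⟨z, hz, h⟩ := hS hs
      exact ⟨⟨z, hz⟩, fun _ => h⟩
    · exact ⟨⟨0, by simp⟩, fun h => absurd h hs⟩
  choose z hz using this
  have hcont : ContinuousOn z S := by
    rw [(hreg 1 x).isInducing.continuousOn_iff]
    exact hφ.congr fun s hs => hz s hs
  have hconst : ∀ s, (fun _ => (z s).1 0 : Fin 1 → ℝ) = (z s).1 := by
    intro s
    ext i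
    rw [Subsingleton.elim i 0]
  refine ⟨fun s => (z s).1 0, ?_, fun s hs => ?_⟩
  · exact (continuous_apply 0).comp_continuousOn (continuous_subtype_val.comp_continuousOn hcont)
  · rw [hconst]
    exact ⟨mem_closedBall_zero_iff.1 (z s).2, hz s hs⟩

theorem mem_openCell_one_of_abs_lt (x : cell C 1) {r : ℝ} (hr : |r| < 1) :
    map 1 x (fun _ => r) ∈ openCell 1 x := by
  refine ⟨_, ?_, rfl⟩
  rw [mem_ball_zero_iff, pi_norm_const]
  exact hr

theorem mapsTo_closedCell_of_mapsTo_openCell [T2Space X] {x : cell C 1} {φ : ℝ → X} {a b : ℝ}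
    (hab : a < b) (hφ : ContinuousOn φ (Icc a b)) (h : MapsTo φ (Ioo a b) (openCell 1 x)) :
    MapsTo φ (Icc a b) (closedCell 1 x) := by
  rw [← closure_Ioo hab.ne] at hφ ⊢
  have := MapsTo.closure_of_continuousOn
    (h.mono_right (RelCWComplex.openCell_subset_closedCell 1 x)) hφ
  rwa [RelCWComplex.isClosed_closedCell.closure_eq] at this

/-- An arc with its interior in an open 1-cell does not close up. -/
theorem IsRegular.ne_of_arc [T2Space X] (hreg : IsRegular C) {x : cell C 1} {φ : ℝ → X} {a b : ℝ}
    (hab : a < b) (hφ : ContinuousOn φ (Icc a b)) (hinj : InjOn φ (Ioo a b))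
    (h : MapsTo φ (Ioo a b) (openCell 1 x)) : φ a ≠ φ b := by
  obtain ⟨k, hk, hkφ⟩ := hreg.exists_coord x hφ (mapsTo_closedCell_of_mapsTo_openCell hab hφ h)
  intro heq
  refine ne_of_continuousOn_of_injOn_Ioo hab hk (fun s hs t ht hst => ?_) ?_
  · refine hinj hs ht ?_
    rw [← (hkφ s (Ioo_subset_Icc_self hs)).2, ← (hkφ t (Ioo_subset_Icc_self ht)).2, hst]
  · have ha := hkφ a (left_mem_Icc.2 hab.le)
    have hb := hkφ b (right_mem_Icc.2 hab.le)
    have := hreg.injOn x (mem_closedBall_zero_iff.2 ha.1) (mem_closedBall_zero_iff.2 hb.1)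
      (ha.2.trans (heq.trans hb.2.symm))
    exact congrFun this 0

/-- An arc with its interior in an open 1-cell and its ends at 0-cells runs through the whole
1-cell. -/
theorem IsRegular.exists_orientation_of_arc [T2Space X] (hreg : IsRegular C) {x : cell C 1}
    {φ : ℝ → X} {a b : ℝ} (hab : a < b) (hφ : ContinuousOn φ (Icc a b)) (hinj : InjOn φ (Ioo a b))
    (h : MapsTo φ (Ioo a b) (openCell 1 x)) (ha : φ a ∈ range (vertexPt (C := C)))
    (hb : φ b ∈ range (vertexPt (C := C))) :
    ∃ s, φ '' Ioo a b = openCell 1 x ∧ φ a = src (x, s) ∧ φ b = tgt (x, s) := by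
  have hne := hreg.ne_of_arc hab hφ hinj h
  obtain ⟨k, hk, hkφ⟩ := hreg.exists_coord x hφ (mapsTo_closedCell_of_mapsTo_openCell hab hφ h)
  have hend : ∀ s ∈ Icc a b, φ s ∈ range (vertexPt (C := C)) → k s = 1 ∨ k s = -1 := by
    intro s hs hsv
    have hle := (hkφ s hs).1
    rw [pi_norm_const, Real.norm_eq_abs] at hle
    rcases hle.lt_or_eq with hlt | heq
    · have := mem_openCell_one_of_abs_lt x hlt
      rw [(hkφ s hs).2] at this
      exact absurd this (notMem_openCell_of_mem_range one_ne_zero x hsv)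
    · exact eq_or_eq_neg_of_abs_eq heq
  have hka := (hkφ a (left_mem_Icc.2 hab.le)).2
  have hkb := (hkφ b (right_mem_Icc.2 hab.le)).2
  have himage : ∀ r : ℝ, |r| < 1 → r ∈ k '' Ioo a b → map 1 x (fun _ => r) ∈ φ '' Ioo a b := by
    rintro _ - ⟨s, hs, rfl⟩
    exact ⟨s, hs, ((hkφ s (Ioo_subset_Icc_self hs)).2).symm⟩
  have hsurj : ∀ z ∈ ball (0 : Fin 1 → ℝ) 1, ∃ r : ℝ, |r| < 1 ∧ z = fun _ => r := by
    intro z hz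
    have hconst : z = fun _ => z 0 := by
      ext i
      rw [Subsingleton.elim i 0]
    refine ⟨z 0, ?_, hconst⟩
    rw [mem_ball_zero_iff, hconst, pi_norm_const] at hz
    exact hz
  rcases hend a (left_mem_Icc.2 hab.le) ha with h1 | h1 <;>
    rcases hend b (right_mem_Icc.2 hab.le) hb with h2 | h2
  · exact absurd (hka.symm.trans
      ((congrArg (fun r => map 1 x fun _ => r) (h1.trans h2.symm)).trans hkb)) hne
  · refine ⟨false, Subset.antisymm h.image_subset ?_, ?_, ?_⟩
    · rintro _ ⟨z, hz, rfl⟩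
      obtain ⟨r, hr, rfl⟩ := hsurj z hz
      refine himage r hr (intermediate_value_Ioo' hab.le hk ?_)
      rw [h1, h2]
      exact ⟨(abs_lt.1 hr).1, (abs_lt.1 hr).2⟩
    · rw [← hka, h1]
      rfl
    · rw [← hkb, h2]
      rfl
  · refine ⟨true, Subset.antisymm h.image_subset ?_, ?_, ?_⟩
    · rintro _ ⟨z, hz, rfl⟩
      obtain ⟨r, hr, rfl⟩ := hsurj z hz
      refine himage r hr (intermediate_value_Ioo hab.le hk ?_)
      rw [h1, h2]
      exact ⟨(abs_lt.1 hr).1, (abs_lt.1 hr).2⟩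
    · rw [← hka, h1]
      rfl
    · rw [← hkb, h2]
      rfl
  · exact absurd (hka.symm.trans
      ((congrArg (fun r => map 1 x fun _ => r) (h1.trans h2.symm)).trans hkb)) hne

/-- A connected subset of the 1-skeleton that avoids the 0-cells lies in a single open 1-cell. -/
theorem exists_subset_openCell_one [T2Space X] [CWComplex.Finite C] {Y : Set X}
    (hY : IsPreconnected Y) (hne : Y.Nonempty) (h : Y ⊆ ⋃ x : cell C 1, openCell 1 x) :
    ∃ x : cell C 1, Y ⊆ openCell 1 x := by
  have : Finite (cell C 1) := RelCWComplex.FiniteType.finite_cell 1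
  have hmem : ∀ p ∈ Y, ∀ x : cell C 1, p ∈ closedCell 1 x → p ∈ openCell 1 x := by
    intro p hp x hpx
    refine (mem_of_mem_closedCell_one hpx).elim id fun hv => ?_
    obtain ⟨y, hy⟩ := mem_iUnion.1 (h hp)
    exact absurd hy (notMem_openCell_of_mem_range one_ne_zero y hv)
  obtain ⟨p, hp⟩ := hne
  obtain ⟨x, hx⟩ := mem_iUnion.1 (h hp)
  have hdisj : ∀ q ∈ Y, q ∈ closedCell 1 x → ∀ y : {y : cell C 1 // y ≠ x},
      q ∉ closedCell 1 y.1 := by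
    intro q hq hqx y hqy
    have := eq_of_mem_openCell (hmem q hq _ hqy) (hmem q hq _ hqx)
    exact y.2 (by simpa using this)
  refine ⟨x, fun q hq => hmem q hq x ?_⟩
  have hcover : Y ⊆ closedCell 1 x ∪ ⋃ y : {y : cell C 1 // y ≠ x}, closedCell 1 y.1 := by
    intro q hq
    obtain ⟨y, hy⟩ := mem_iUnion.1 (h hq)
    have hy := RelCWComplex.openCell_subset_closedCell _ _ hy
    by_cases hyx : y = x
    · exact Or.inl (hyx ▸ hy)
    · exact Or.inr (mem_iUnion.2 ⟨⟨y, hyx⟩, hy⟩)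
  have hempty : Y ∩ (closedCell 1 x ∩ ⋃ y : {y : cell C 1 // y ≠ x}, closedCell 1 y.1) = ∅ := by
    refine eq_empty_iff_forall_notMem.2 ?_
    rintro q ⟨hq, hqx, hqy⟩
    obtain ⟨y, hy⟩ := mem_iUnion.1 hqy
    exact hdisj q hq hqx y hy
  rcases isPreconnected_iff_subset_of_disjoint_closed.1 hY _ _ RelCWComplex.isClosed_closedCell
    (isClosed_iUnion_of_finite fun _ => RelCWComplex.isClosed_closedCell) hcover hempty with H | H
  · exact H hq
  · obtain ⟨y, hy⟩ := mem_iUnion.1 (H hp)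
    exact absurd hy (hdisj p hp (RelCWComplex.openCell_subset_closedCell _ _ hx) y)

/-! ### Boundary words -/

/-- The attaching map of a 2-cell of a regular complex traverses a cycle of 1-cells: the points that
it carries to 0-cells cut the circle into arcs, and each of them runs through a whole 1-cell. There
is at least one such point, since a circle does not embed into an open 1-cell. -/
theorem IsRegular.exists_isBoundaryWord [T2Space X] [CWComplex.Finite C] (hreg : IsRegular C)
    (e : cell C 2) : ∃ w, IsBoundaryWord e w := by
  have hfin : Finite (cell C 0) := RelCWComplex.FiniteType.finite_cell 0
  have hsphere : ∀ s, squareParam s ∈ sphere (0 : Fin 2 → ℝ) 1 := fun s =>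
    mem_sphere_zero_iff_norm.2 (norm_squareParam s)
  have hball : ∀ s, squareParam s ∈ closedBall (0 : Fin 2 → ℝ) 1 := fun s =>
    sphere_subset_closedBall (hsphere s)
  have hcont : ∀ s₀ : ℝ, Continuous fun s => map 2 e (squareParam (s₀ + s)) := fun s₀ =>
    (RelCWComplex.continuousOn 2 e).comp_continuous
      (continuous_squareParam.comp (by fun_prop)) fun s => hball _
  have hinj : ∀ s₀ : ℝ, InjOn (fun s => map 2 e (squareParam (s₀ + s))) (Ico 0 1) :=
    fun s₀ s hs t ht hst =>
      injOn_squareParam_add s₀ hs ht (hreg.injOn e (hball _) (hball _) hst)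
  have hperiod : ∀ s₀ : ℝ, squareParam (s₀ + 0) = squareParam (s₀ + 1) := fun s₀ =>
    squareParam_eq_iff.2 ⟨-1, by push_cast; ring⟩
  have hfrontier : ∀ s, map 2 e (squareParam s) ∉ range (vertexPt (C := C)) →
      map 2 e (squareParam s) ∈ ⋃ x : cell C 1, openCell 1 x := fun s hs =>
    (cellFrontier_two_subset e ⟨_, hsphere s, rfl⟩).resolve_left hs
  obtain ⟨s₀, hs₀⟩ : ∃ s, map 2 e (squareParam s) ∈ range (vertexPt (C := C)) := by
    by_contra! H
    obtain ⟨x, hx⟩ := exists_subset_openCell_one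
      ((isPreconnected_Icc (a := (0 : ℝ)) (b := 1)).image _ (hcont 0).continuousOn)
      ⟨_, mem_image_of_mem _ (left_mem_Icc.2 zero_le_one)⟩
      (by
        rintro _ ⟨s, -, rfl⟩
        exact hfrontier _ (H _))
    exact hreg.ne_of_arc zero_lt_one (hcont 0).continuousOn ((hinj 0).mono Ioo_subset_Ico_self)
      (fun s hs => hx (mem_image_of_mem _ (Ioo_subset_Icc_self hs)))
      (congrArg (map 2 e) (hperiod 0))
  set φ : ℝ → X := fun s => map 2 e (squareParam (s₀ + s)) with hφ
  have hφ₀ : φ 0 ∈ range (vertexPt (C := C)) := by simpa [hφ] using hs₀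
  have hφ₁ : φ 1 ∈ range (vertexPt (C := C)) := by
    have : φ 1 = φ 0 := congrArg (map 2 e) (hperiod s₀).symm
    rwa [this]
  have hZ : (Icc (0 : ℝ) 1 ∩ φ ⁻¹' range (vertexPt (C := C))).Finite := by
    have h₁ : (Ico (0 : ℝ) 1 ∩ φ ⁻¹' range (vertexPt (C := C))).Finite :=
      Finite.of_finite_image ((finite_range (vertexPt (C := C))).subset (by
        rintro _ ⟨s, hs, rfl⟩
        exact hs.2)) ((hinj s₀).mono inter_subset_left)
    refine (h₁.union (finite_singleton 1)).subset ?_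
    rintro s ⟨hs, hsv⟩
    rcases hs.2.lt_or_eq with h | rfl
    · exact Or.inl ⟨⟨hs.1, h⟩, hsv⟩
    · exact Or.inr rfl
  obtain ⟨n, t, ht₀, ht₁, hlt, htZ, hgap⟩ := exists_subdivision hZ.toFinset
    (by simpa using hφ₀) (by simpa using hφ₁) (fun z hz => by
      rw [Finite.mem_toFinset] at hz
      exact hz.1)
  have htZ' : ∀ i ≤ n, t i ∈ Icc (0 : ℝ) 1 ∧ φ (t i) ∈ range (vertexPt (C := C)) := fun i hi => by
    have := htZ i hi
    rwa [Finite.mem_toFinset] at this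
  have hletter : ∀ i : Fin n, ∃ a : cell C 1 × Bool,
      φ '' Ioo (t i) (t (i + 1)) = openCell 1 a.1 ∧ φ (t i) = src a ∧ φ (t (i + 1)) = tgt a := by
    intro i
    have hi := hlt i i.2
    have hsub : Ioo (t i) (t (i + 1)) ⊆ Ico 0 1 := fun s hs =>
      ⟨(htZ' i i.2.le).1.1.trans hs.1.le, hs.2.trans_le (htZ' (i + 1) i.2).1.2⟩
    have hmem : φ '' Ioo (t i) (t (i + 1)) ⊆ ⋃ x : cell C 1, openCell 1 x := by
      rintro _ ⟨s, hs, rfl⟩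
      refine hfrontier _ fun hv => hgap i i.2 s ?_ hs
      rw [Finite.mem_toFinset]
      exact ⟨Ico_subset_Icc_self (hsub hs), hv⟩
    obtain ⟨x, hx⟩ := exists_subset_openCell_one
      (isPreconnected_Ioo.image _ (hcont s₀).continuousOn) ((nonempty_Ioo.2 hi).image _) hmem
    obtain ⟨s, hs⟩ := hreg.exists_orientation_of_arc hi (hcont s₀).continuousOn
      ((hinj s₀).mono hsub) (fun s hs => hx (mem_image_of_mem _ hs)) (htZ' i i.2.le).2
      (htZ' (i + 1) i.2).2
    exact ⟨(x, s), hs⟩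
  choose a ha using hletter
  refine ⟨List.ofFn a, fun s => squareParam (s₀ + s), t, ?_, hperiod s₀,
    injOn_squareParam_add s₀, squareParam_add_image s₀, ht₀, by simpa using ht₁,
    by simpa using hlt, fun i hi => ?_⟩
  · exact (continuous_squareParam.comp (by fun_prop)).continuousOn
  · simp only [List.length_ofFn] at hi
    obtain ⟨h₁, h₂, h₃⟩ := ha ⟨i, hi⟩
    simp only [List.getElem_ofFn]
    exact ⟨h₁, h₂.symm ▸ rfl, h₃.symm ▸ rfl⟩

theorem isEdgePath_of_forall {w : List (cell C 1 × Bool)} {P : ℕ → X}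
    (h : ∀ (i : ℕ) (hi : i < w.length), P i = src w[i] ∧ P (i + 1) = tgt w[i]) :
    IsEdgePath w (P 0) (P w.length) := by
  induction w generalizing P with
  | nil => rfl
  | cons a w ih =>
    have h₀ := h 0 (by simp)
    refine ⟨h₀.1.symm, ?_⟩
    have := ih (P := fun i => P (i + 1)) fun i hi => by
      exact h (i + 1) (by simpa using hi)
    rw [← show P 1 = tgt a from h₀.2]
    exact this

/-- In a regular complex, a boundary word of a 2-cell is a simple cycle. -/
theorem IsBoundaryWord.isSimpleCycle (hreg : IsRegular C) {e : cell C 2}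
    {w : List (cell C 1 × Bool)} (h : IsBoundaryWord e w) : IsSimpleCycle w := by
  obtain ⟨γ, t, -, hγ, hinj, himage, ht₀, ht₁, hlt, harc⟩ := h
  have hball : ∀ s ∈ Icc (0 : ℝ) 1, γ s ∈ closedBall (0 : Fin 2 → ℝ) 1 := fun s hs =>
    sphere_subset_closedBall (himage ▸ mem_image_of_mem γ hs)
  have hinj' : ∀ s ∈ Ico (0 : ℝ) 1, ∀ s' ∈ Ico (0 : ℝ) 1,
      map 2 e (γ s) = map 2 e (γ s') → s = s' := fun s hs s' hs' hss' =>
    hinj hs hs' (hreg.injOn e (hball s (Ico_subset_Icc_self hs))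
      (hball s' (Ico_subset_Icc_self hs')) hss')
  have hnonneg : ∀ i ≤ w.length, 0 ≤ t i := fun i hi => by
    rcases Nat.eq_zero_or_pos i with rfl | h
    · exact ht₀.ge
    · exact ht₀ ▸ (lt_of_forall_lt_succ hlt h hi).le
  have hlt_one : ∀ i < w.length, t i < 1 := fun i hi => ht₁ ▸ lt_of_forall_lt_succ hlt hi le_rfl
  have hIco : ∀ i < w.length, t i ∈ Ico (0 : ℝ) 1 := fun i hi => ⟨hnonneg i hi.le, hlt_one i hi⟩
  refine ⟨⟨map 2 e (γ (t 0)), ?_⟩, ?_, ?_, ?_⟩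
  · have := isEdgePath_of_forall (w := w) (P := fun i => map 2 e (γ (t i))) fun i hi =>
      (harc i hi).2
    simp only [ht₁, ← hγ] at this
    rwa [ht₀] at this ⊢
  · refine List.pairwise_iff_getElem.2 fun i j hi hj hij => ?_
    simp only [List.length_map] at hi hj
    simp only [List.getElem_map]
    rw [← (harc i hi).2.1, ← (harc j hj).2.1]
    intro H
    exact (lt_of_forall_lt_succ hlt hij hj.le).ne (hinj' _ (hIco i hi) _ (hIco j hj) H)
  · refine List.pairwise_iff_getElem.2 fun i j hi hj hij => ?_
    simp only [List.length_map] at hi hj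
    simp only [List.getElem_map]
    rw [← (harc i hi).2.2, ← (harc j hj).2.2]
    intro H
    rcases Nat.lt_or_eq_of_le (Nat.succ_le_of_lt hj) with hj' | hj'
    · exact (lt_of_forall_lt_succ hlt (Nat.succ_lt_succ hij) hj'.le).ne
        (hinj' _ (hIco (i + 1) (by omega)) _ (hIco (j + 1) hj') H)
    · -- the last subdivision point is `1`, where the circle closes up
      have hj'' : t (j + 1) = 1 := by rw [← ht₁, ← hj']
      rw [hj'', ← hγ] at H
      have := hinj' _ (hIco (i + 1) (by omega)) 0 ⟨le_rfl, zero_lt_one⟩ H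
      exact (lt_of_forall_lt_succ hlt (Nat.succ_pos i) (by omega)).ne (ht₀.trans this.symm)
  · refine List.pairwise_iff_getElem.2 fun i j hi hj hij => ?_
    simp only [List.length_map] at hi hj
    simp only [List.getElem_map]
    intro H
    obtain ⟨s, hs⟩ := nonempty_Ioo.2 (hlt i hi)
    have hmem : map 2 e (γ s) ∈ openCell 1 w[j].1 := by
      rw [← H, ← (harc i hi).1]
      exact ⟨s, hs, rfl⟩
    rw [← (harc j hj).1] at hmem
    obtain ⟨s', hs', hss'⟩ := hmem
    have hle : t (i + 1) ≤ t j := by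
      rcases Nat.lt_or_eq_of_le (Nat.succ_le_of_lt hij) with h | h
      · exact (lt_of_forall_lt_succ hlt h hj.le).le
      · exact le_of_eq (congrArg t h)
    have hle' : t (j + 1) ≤ 1 := by
      rcases Nat.lt_or_eq_of_le (Nat.succ_le_of_lt hj) with h | h
      · exact (hlt_one _ h).le
      · exact le_of_eq ((congrArg t h).trans ht₁)
    have h₀ := hnonneg i hi.le
    have h₁ := hs.1
    have h₂ := hs.2
    have h₃ := hs'.1
    have h₄ := hs'.2
    have := hinj' s' ⟨by linarith, by linarith⟩ s ⟨by linarith, by linarith⟩ hss'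
    linarith

theorem IsBoundaryWord.openCell_subset {e : cell C 2} {w : List (cell C 1 × Bool)}
    (h : IsBoundaryWord e w) {x : cell C 1} (hx : x ∈ w.map Prod.fst) :
    openCell 1 x ⊆ cellFrontier 2 e := by
  obtain ⟨γ, t, -, -, -, himage, ht₀, ht₁, hlt, harc⟩ := h
  obtain ⟨a, ha, rfl⟩ := List.mem_map.1 hx
  obtain ⟨i, hi, rfl⟩ := List.getElem_of_mem ha
  rw [← (harc i hi).1]
  rintro _ ⟨s, hs, rfl⟩
  refine ⟨γ s, ?_, rfl⟩
  rw [← himage]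
  refine mem_image_of_mem γ ⟨?_, ?_⟩
  · rcases Nat.eq_zero_or_pos i with rfl | h
    · exact ht₀ ▸ hs.1.le
    · exact ht₀ ▸ ((lt_of_forall_lt_succ hlt h hi.le).trans hs.1).le
  · rcases Nat.lt_or_eq_of_le (Nat.succ_le_of_lt hi) with h | h
    · exact ht₁ ▸ (hs.2.trans (lt_of_forall_lt_succ hlt h le_rfl)).le
    · exact (hs.2.trans_eq ((congrArg t h).trans ht₁)).le

theorem IsBoundaryWord.cellFrontier_subset {e : cell C 2} {w : List (cell C 1 × Bool)}
    (h : IsBoundaryWord e w) {p : X} (hp : p ∈ cellFrontier 2 e) :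
    ∃ a ∈ w, p ∈ openCell 1 a.1 ∨ p = src a ∨ p = tgt a := by
  obtain ⟨γ, t, -, -, -, himage, ht₀, ht₁, -, harc⟩ := h
  have hlen : 0 < w.length := by
    rcases Nat.eq_zero_or_pos w.length with h | h
    · rw [h, ht₀] at ht₁
      exact absurd ht₁ zero_ne_one
    · exact h
  obtain ⟨z, hz, rfl⟩ := hp
  rw [← himage] at hz
  obtain ⟨s, hs, rfl⟩ := hz
  obtain ⟨i, hi, his⟩ := exists_mem_Icc_of_subdivision (t := t) hlen (s := s) (by rwa [ht₀, ht₁])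
  refine ⟨w[i], List.getElem_mem hi, ?_⟩
  obtain ⟨h₁, h₂, h₃⟩ := harc i hi
  rcases his.1.eq_or_lt with rfl | hlt
  · exact Or.inr (Or.inl h₂)
  rcases his.2.eq_or_lt with rfl | hlt'
  · exact Or.inr (Or.inr h₃)
  · exact Or.inl (h₁ ▸ ⟨s, ⟨hlt, hlt'⟩, rfl⟩)

theorem IsBoundaryWord.mem_of_mem_openCell {e : cell C 2} {w : List (cell C 1 × Bool)}
    (h : IsBoundaryWord e w) {x : cell C 1} {p : X} (hp : p ∈ cellFrontier 2 e)
    (hx : p ∈ openCell 1 x) : x ∈ w.map Prod.fst := by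
  obtain ⟨a, ha, h | rfl | rfl⟩ := h.cellFrontier_subset hp
  · have : x = a.1 := by simpa using eq_of_mem_openCell hx h
    exact this ▸ List.mem_map_of_mem ha
  · exact absurd hx (notMem_openCell_of_mem_range one_ne_zero x (src_mem_range a))
  · exact absurd hx (notMem_openCell_of_mem_range one_ne_zero x (tgt_mem_range a))

theorem IsBoundaryWord.mem_iff_mem {e : cell C 2} {w w' : List (cell C 1 × Bool)}
    (h : IsBoundaryWord e w) (h' : IsBoundaryWord e w') (x : cell C 1) :
    x ∈ w.map Prod.fst ↔ x ∈ w'.map Prod.fst := by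
  obtain ⟨p, hp⟩ := RelCWComplex.openCell_nonempty 1 x
  exact ⟨fun hx => h'.mem_of_mem_openCell (h.openCell_subset hx hp) hp,
    fun hx => h.mem_of_mem_openCell (h'.openCell_subset hx hp) hp⟩

/-! ### The covering relation in the face poset -/

theorem IsFace.eq_of_zero {c : Cells C} {v : cell C 0} (h : IsFace c ⟨0, v⟩) : c = ⟨0, v⟩ := by
  obtain ⟨p, hp⟩ := RelCWComplex.openCell_nonempty c.1 c.2
  have hpv : p ∈ openCell 0 v := by
    have := h hp
    rwa [closedCell_zero, ← openCell_zero] at this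
  exact eq_of_mem_openCell hp hpv

theorem not_covers_zero {c : Cells C} {v : cell C 0} : ¬ Covers c ⟨0, v⟩ :=
  fun h => h.1.2 h.1.1.eq_of_zero

theorem isFace_zero_iff {v : cell C 0} {c : Cells C} :
    IsFace ⟨0, v⟩ c ↔ vertexPt v ∈ closedCell c.1 c.2 := by
  rw [IsFace, openCell_zero, singleton_subset_iff]

theorem IsFace.mem_cellFrontier {v : cell C 0} {n : ℕ} {c : cell C n} (hn : n ≠ 0)
    (h : IsFace (⟨0, v⟩ : Cells C) ⟨n, c⟩) : vertexPt v ∈ cellFrontier n c := by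
  have := isFace_zero_iff.1 h
  rw [← RelCWComplex.cellFrontier_union_openCell_eq_closedCell] at this
  exact this.resolve_right (notMem_openCell_of_mem_range hn c (mem_range_self v))

/-- A proper face of a cell lies in its frontier. -/
theorem IsFace.openCell_subset_cellFrontier {c c' : Cells C} (h : IsFace c c') (hne : c ≠ c') :
    openCell c.1 c.2 ⊆ cellFrontier c'.1 c'.2 := by
  intro p hp
  have := h hp
  rw [← RelCWComplex.cellFrontier_union_openCell_eq_closedCell] at this
  exact this.resolve_right fun hp' => hne (eq_of_mem_openCell hp hp')

theorem isFace_one_cases {c : Cells C} {x : cell C 1} (h : IsFace c ⟨1, x⟩) (hne : c ≠ ⟨1, x⟩) :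
    ∃ v : cell C 0, c = ⟨0, v⟩ := by
  obtain ⟨p, hp⟩ := RelCWComplex.openCell_nonempty c.1 c.2
  obtain ⟨v, rfl⟩ := cellFrontier_one_subset x (h.openCell_subset_cellFrontier hne hp)
  exact ⟨v, eq_of_mem_openCell hp (by rw [openCell_zero]; rfl)⟩

theorem covers_of_mem_cellFrontier_one {v : cell C 0} {x : cell C 1}
    (h : vertexPt v ∈ cellFrontier 1 x) : Covers (⟨0, v⟩ : Cells C) ⟨1, x⟩ := by
  refine ⟨⟨isFace_zero_iff.2 (RelCWComplex.cellFrontier_subset_closedCell 1 x h), ?_⟩, ?_⟩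
  · intro H
    exact zero_ne_one (congrArg Sigma.fst H)
  · rintro ⟨c, ⟨h₁, h₂⟩, h₃, h₄⟩
    obtain ⟨v', rfl⟩ := isFace_one_cases h₃ h₄
    exact h₂ h₁.eq_of_zero

theorem IsBoundaryWord.covers {e : cell C 2} {w : List (cell C 1 × Bool)}
    (h : IsBoundaryWord e w) {x : cell C 1} (hx : x ∈ w.map Prod.fst) :
    Covers (⟨1, x⟩ : Cells C) ⟨2, e⟩ := by
  refine ⟨⟨(h.openCell_subset hx).trans (RelCWComplex.cellFrontier_subset_closedCell 2 e), ?_⟩, ?_⟩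
  · intro H
    exact absurd (congrArg Sigma.fst H) (by simp)
  · rintro ⟨c, ⟨h₁, h₂⟩, h₃, h₄⟩
    obtain ⟨p, hp⟩ := RelCWComplex.openCell_nonempty c.1 c.2
    rcases cellFrontier_two_subset e (h₃.openCell_subset_cellFrontier h₄ hp) with ⟨v, rfl⟩ | hpy
    · obtain rfl : c = ⟨0, v⟩ := eq_of_mem_openCell hp (by rw [openCell_zero]; rfl)
      exact h₂ h₁.eq_of_zero
    · obtain ⟨y, hy⟩ := mem_iUnion.1 hpy
      obtain rfl : c = ⟨1, y⟩ := eq_of_mem_openCell hp hy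
      obtain ⟨v, hv⟩ := isFace_one_cases h₁ h₂
      exact absurd (congrArg Sigma.fst hv) (by simp)

theorem IsBoundaryWord.mem_of_covers {e : cell C 2} {w : List (cell C 1 × Bool)}
    (h : IsBoundaryWord e w) {x : cell C 1} (hx : Covers (⟨1, x⟩ : Cells C) ⟨2, e⟩) :
    x ∈ w.map Prod.fst := by
  obtain ⟨p, hp⟩ := RelCWComplex.openCell_nonempty 1 x
  exact h.mem_of_mem_openCell (hx.1.1.openCell_subset_cellFrontier hx.1.2 hp) hp

theorem IsBoundaryWord.not_covers_zero {e : cell C 2} {w : List (cell C 1 × Bool)}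
    (h : IsBoundaryWord e w) (v : cell C 0) : ¬ Covers (⟨0, v⟩ : Cells C) ⟨2, e⟩ := by
  intro hv
  have hw : ∃ a ∈ w, vertexPt v ∈ cellFrontier 1 a.1 := by
    obtain ⟨a, ha, h | h | h⟩ := h.cellFrontier_subset (hv.1.1.mem_cellFrontier two_ne_zero)
    · exact absurd h (notMem_openCell_of_mem_range one_ne_zero _ (mem_range_self v))
    · exact ⟨a, ha, h ▸ src_mem_cellFrontier a⟩
    · exact ⟨a, ha, h ▸ tgt_mem_cellFrontier a⟩
  obtain ⟨a, ha, hva⟩ := hw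
  exact hv.2 ⟨⟨1, a.1⟩, (covers_of_mem_cellFrontier_one hva).1,
    (h.covers (List.mem_map_of_mem ha)).1⟩

/-! ### Acyclic matchings -/

theorem finite_cells [CWComplex.Finite C] (hdim : ∀ n : ℕ, 2 < n → IsEmpty (cell C n)) :
    Finite (Cells C) := by
  have : ∀ n, Finite (cell C n) := RelCWComplex.FiniteType.finite_cell
  refine Finite.of_surjective
    (fun c : Σ n : Fin 3, cell C n => (⟨c.1, c.2⟩ : Cells C)) fun ⟨n, c⟩ => ?_
  have hn : n < 3 := by
    by_contra h
    exact (hdim n (by omega)).false c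
  exact ⟨⟨⟨n, hn⟩, c⟩, rfl⟩

/-- The number of cells that precede `c` in the modified Hasse diagram. -/
noncomputable def hasseRank (M : Set (Cells C × Cells C)) (c : Cells C) : ℕ :=
  {c' | Relation.TransGen (ModifiedHasse M) c' c}.ncard

theorem IsAcyclicMatching.hasseRank_lt [Finite (Cells C)] {M : Set (Cells C × Cells C)}
    (hM : IsAcyclicMatching M) {c c' : Cells C} (h : ModifiedHasse M c c') :
    hasseRank M c < hasseRank M c' := by
  refine ncard_lt_ncard ⟨fun d hd => hd.tail h, fun H => ?_⟩ (toFinite _)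
  exact hM.acyclic c (H (Relation.TransGen.single h))

/-- If `c` is matched with `c'`, then the other faces that `c'` covers have smaller rank than `c`. -/
theorem IsAcyclicMatching.hasseRank_lt_of_covers [Finite (Cells C)] {M : Set (Cells C × Cells C)}
    (hM : IsAcyclicMatching M) {c c' d : Cells C} (h : (c, c') ∈ M) (hd : Covers d c')
    (hne : d ≠ c) : hasseRank M d < hasseRank M c := by
  refine (hM.hasseRank_lt (Or.inl ⟨hd, fun H => hne ?_⟩)).trans
    (hM.hasseRank_lt (Or.inr ⟨hM.covers _ h, h⟩))
  exact congrArg Prod.fst (hM.matching _ H _ h c' (Or.inr rfl) (Or.inr rfl))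

theorem IsAcyclicMatching.exists_of_not_isCritical [T2Space X] [CWComplex.Finite C]
    (hreg : IsRegular C) (hdim : ∀ n : ℕ, 2 < n → IsEmpty (cell C n))
    {M : Set (Cells C × Cells C)} (hM : IsAcyclicMatching M) {v : cell C 0}
    (hv : ¬ IsCritical M ⟨0, v⟩) : ∃ x : cell C 1, ((⟨0, v⟩, ⟨1, x⟩) : Cells C × Cells C) ∈ M := by
  simp only [IsCritical, not_forall, not_and_or, not_not] at hv
  obtain ⟨⟨c, d⟩, hp, h | h⟩ := hv
  · obtain rfl : (⟨0, v⟩ : Cells C) = c := h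
    obtain ⟨n, d⟩ := d
    have hcov := hM.covers _ hp
    match n with
    | 0 => exact absurd hcov not_covers_zero
    | 1 => exact ⟨d, hp⟩
    | 2 =>
      obtain ⟨w, hw⟩ := hreg.exists_isBoundaryWord d
      exact absurd hcov (hw.not_covers_zero v)
    | n + 3 => exact ((hdim (n + 3) (by omega)).false d).elim
  · obtain rfl : (⟨0, v⟩ : Cells C) = d := h
    exact absurd (hM.covers _ hp) not_covers_zero

/-- With a single critical 0-cell, the matched 1-cells form a spanning tree: every other 0-cell is
matched with a 1-cell, whose other end has smaller rank. -/
theorem IsAcyclicMatching.isSpanningTree_treeOf [T2Space X] [CWComplex.Finite C]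
    (hreg : IsRegular C) (hdim : ∀ n : ℕ, 2 < n → IsEmpty (cell C n))
    {M : Set (Cells C × Cells C)} (hM : IsAcyclicMatching M)
    (hcrit : ∃! v : cell C 0, IsCritical M ⟨0, v⟩) : IsSpanningTree (treeOf M) := by
  have := finite_cells hdim
  obtain ⟨root, hroot, huniq⟩ := hcrit
  classical
  let ht : X → ℕ := fun p =>
    if h : p ∈ range (vertexPt (C := C)) then hasseRank M ⟨0, h.choose⟩ else 0
  have hht : ∀ v : cell C 0, ht (vertexPt v) = hasseRank M ⟨0, v⟩ := by
    intro v
    have h : vertexPt v ∈ range (vertexPt (C := C)) := mem_range_self v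
    simp only [ht, dif_pos h]
    rw [vertexPt_injective h.choose_spec]
  -- a matched 1-cell leads down from the 0-cell that it is matched with
  have hlt : ∀ (v : cell C 0) (x : cell C 1), ((⟨0, v⟩, ⟨1, x⟩) : Cells C × Cells C) ∈ M →
      ∃ s, src (x, s) = vertexPt v ∧ ht (tgt (x, s)) < ht (src (x, s)) := by
    intro v x hx
    obtain ⟨s, hs⟩ := exists_src_eq_of_mem_cellFrontier
      ((hM.covers _ hx).1.1.mem_cellFrontier one_ne_zero)
    obtain ⟨v', hv'⟩ := tgt_mem_range (x, s)
    refine ⟨s, hs, ?_⟩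
    rw [hs, ← hv', hht, hht]
    refine hM.hasseRank_lt_of_covers hx
      (covers_of_mem_cellFrontier_one (hv' ▸ tgt_mem_cellFrontier (x, s))) fun H => ?_
    obtain rfl : v' = v := by simpa using H
    exact hreg.src_ne_tgt (x, s) (hs.trans hv')
  have hcases : ∀ a : cell C 1 × Bool, a.1 ∈ treeOf M → ht (src a) ≠ ht (tgt a) ∧
      (ht (tgt a) < ht (src a) → ∃ v : cell C 0, src a = vertexPt v ∧
        ((⟨0, v⟩, ⟨1, a.1⟩) : Cells C × Cells C) ∈ M) := by
    rintro a ⟨v, hv⟩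
    obtain ⟨s, hs, hlt⟩ := hlt v a.1 hv
    rcases eq_or_eq_not_of_fst_eq (show a.1 = (a.1, s).1 from rfl) with h | h
    · rw [← h] at hs hlt
      exact ⟨hlt.ne', fun _ => ⟨v, hs, hv⟩⟩
    · have h₁ : src a = tgt (a.1, s) := (congrArg src h).trans (src_not _ _)
      have h₂ : tgt a = src (a.1, s) := (congrArg tgt h).trans (tgt_not _ _)
      rw [h₁, h₂]
      exact ⟨hlt.ne, fun h => absurd hlt h.not_gt⟩
  refine isSpanningTree_of_height root ht (fun v hv => ?_) (fun a ha => (hcases a ha).1)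
    fun a b ha hb hab hlta hltb => ?_
  · obtain ⟨x, hx⟩ := hM.exists_of_not_isCritical hreg hdim fun h => hv (huniq v h)
    obtain ⟨s, hs, hlt⟩ := hlt v x hx
    exact ⟨(x, s), ⟨v, hx⟩, hs, hlt⟩
  · obtain ⟨v, hv, hva⟩ := (hcases a ha).2 hlta
    obtain ⟨v', hv', hvb⟩ := (hcases b hb).2 hltb
    obtain rfl : v = v' := vertexPt_injective (hv.symm.trans (hab.trans hv'))
    simpa using congrArg Prod.snd (hM.matching _ hva _ hvb ⟨0, v⟩ (Or.inl rfl) (Or.inl rfl))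

/-! ### The Morse presentation -/

theorem collapse_mk_mem_belowRank {T : Set (cell C 1)} {ρ : {x : cell C 1 // x ∉ T} → ℕ} {n : ℕ}
    {w : List (cell C 1 × Bool)} (hw : ∀ a ∈ w, ∀ h : a.1 ∉ T, ρ ⟨a.1, h⟩ < n) :
    collapse T (FreeGroup.mk w) ∈ GroupPres.belowRank ρ n := by
  induction w with
  | nil => exact one_mem _
  | cons a w ih =>
    rw [mk_cons, map_mul, mk_singleton]
    refine mul_mem ?_ (ih fun b hb => hw b (List.mem_cons_of_mem _ hb))
    have ha : collapse T (FreeGroup.of a.1) ∈ GroupPres.belowRank ρ n := by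
      by_cases h : a.1 ∈ T
      · rw [collapse_of_mem h]
        exact one_mem _
      · rw [collapse_of_notMem h]
        exact GroupPres.of_mem_belowRank (hw a (by simp) h)
    obtain ⟨x, _ | _⟩ := a
    · rw [cond_false, map_inv]
      exact inv_mem ha
    · exact ha

/-- In the relator of a matched 2-cell, the 1-cell matched with it occurs once, and its rank is
larger than that of the other letters. -/
theorem IsAcyclicMatching.isLeading [CWComplex.Finite C] [Finite (Cells C)] (hreg : IsRegular C)
    {M : Set (Cells C × Cells C)} (hM : IsAcyclicMatching M)
    {b : cell C 2 → List (cell C 1 × Bool)} (hb : ∀ e, IsBoundaryWord e (b e))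
    {x : {x : cell C 1 // x ∉ treeOf M}} {e : cell C 2}
    (h : ((⟨1, x.1⟩, ⟨2, e⟩) : Cells C × Cells C) ∈ M) :
    (initialPres M b).IsLeading (fun y => hasseRank M ⟨1, y.1⟩) x e := by
  obtain ⟨a, ha, hax⟩ := List.mem_map.1 ((hb e).mem_of_covers (hM.covers _ h))
  obtain ⟨s, t, hst⟩ := List.append_of_mem ha
  have hnodup := ((hb e).isSimpleCycle hreg).nodup_fst
  rw [hst, List.map_append, List.map_cons, List.nodup_middle, List.nodup_cons] at hnodup
  have hrank : ∀ c ∈ s ++ t, hasseRank M ⟨1, c.1⟩ < hasseRank M ⟨1, x.1⟩ := by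
    intro c hc
    refine hM.hasseRank_lt_of_covers h ((hb e).covers (List.mem_map_of_mem ?_)) fun H => ?_
    · rw [hst]
      simp only [List.mem_append, List.mem_cons] at hc ⊢
      tauto
    · have hcx : c.1 = a.1 := by
        rw [hax]
        simpa using H
      refine hnodup.1 ?_
      rw [← List.map_append, ← hcx]
      exact List.mem_map_of_mem hc
  refine ⟨collapse (treeOf M) (FreeGroup.mk s),
    collapse_mk_mem_belowRank fun c hc _ => hrank c (List.mem_append_left _ hc),
    collapse (treeOf M) (FreeGroup.mk t),
    collapse_mk_mem_belowRank fun c hc _ => hrank c (List.mem_append_right _ hc),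
    cond a.2 1 (-1), by cases a.2 <;> simp, ?_⟩
  change FreeGroup.mk (deleteTree (treeOf M) (b e)) = _
  rw [mk_deleteTree, hst, ← FreeGroup.mul_mk, mk_cons, map_mul, map_mul, mk_singleton, hax,
    ← mul_assoc]
  congr 2
  cases a.2
  · simp [collapse_of_notMem x.2]
    rfl
  · simp [collapse_of_notMem x.2]
    rfl

theorem IsAcyclicMatching.exists_isMorsePres [CWComplex.Finite C] [Finite (Cells C)]
    (hreg : IsRegular C) {M : Set (Cells C × Cells C)} (hM : IsAcyclicMatching M)
    {b : cell C 2 → List (cell C 1 × Bool)} (hb : ∀ e, IsBoundaryWord e (b e))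
    {l : List ({x : cell C 1 // x ∉ treeOf M} × cell C 2)} (hl : Enumerates M l) :
    ∃ Q, IsMorsePres M b l Q := by
  have hmem : ∀ p ∈ l, ((⟨1, p.1.1⟩, ⟨2, p.2⟩) : Cells C × Cells C) ∈ M := fun p hp =>
    (hl.2 p.1 p.2).1 hp
  have h₁ : (l.map Prod.fst).Nodup := by
    refine hl.1.map_on fun p hp q hq hpq => Prod.ext hpq ?_
    simpa using congrArg Prod.snd (hM.matching _ (hmem p hp) _ (hmem q hq) ⟨1, p.1.1⟩ (Or.inl rfl)
      (Or.inl (by rw [hpq])))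
  have h₂ : (l.map Prod.snd).Nodup := by
    refine hl.1.map_on fun p hp q hq hpq => Prod.ext (Subtype.ext ?_) hpq
    simpa using congrArg Prod.fst (hM.matching _ (hmem p hp) _ (hmem q hq) ⟨2, p.2⟩ (Or.inr rfl)
      (Or.inr (by rw [hpq])))
  obtain ⟨Q, hQ⟩ := (initialPres M b).exists_isReduction (fun y => hasseRank M ⟨1, y.1⟩) l h₁ h₂
    fun p hp => hM.isLeading hreg hb (hmem p hp)
  exact ⟨Q, hl, hQ⟩

end

end CWMorse

theorem mainTheorem4 {X : Type u} [TopologicalSpace X] [T2Space X] (C : Set X)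
    [Topology.CWComplex C] [Topology.CWComplex.Finite C]
    (hreg : CWMorse.IsRegular C)
    (hdim : ∀ n : ℕ, 2 < n → IsEmpty (Topology.RelCWComplex.cell C n))
    (M : Set (CWMorse.Cells C × CWMorse.Cells C)) (hM : CWMorse.IsAcyclicMatching M)
    (hcrit : ∃! v : Topology.RelCWComplex.cell C 0, CWMorse.IsCritical M ⟨0, v⟩) :
    -- the standard presentations and the Morse presentation are well defined
    (∀ e : Topology.RelCWComplex.cell C 2, ∃ w, CWMorse.IsBoundaryWord e w) ∧
    CWMorse.IsSpanningTree (CWMorse.treeOf M) ∧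
    ∀ b : Topology.RelCWComplex.cell C 2 → List (Topology.RelCWComplex.cell C 1 × Bool),
      (∀ e, CWMorse.IsBoundaryWord e (b e)) →
      ∀ l, CWMorse.Enumerates M l →
        (∃ Q, CWMorse.IsMorsePres M b l Q) ∧
        -- the Morse presentation is equivalent to every standard presentation
        ∀ Q, CWMorse.IsMorsePres M b l Q →
          ∀ T : Set (Topology.RelCWComplex.cell C 1), CWMorse.IsSpanningTree T →
          ∀ b' : Topology.RelCWComplex.cell C 2 → List (Topology.RelCWComplex.cell C 1 × Bool),
            (∀ e, CWMorse.IsBoundaryWord e (b' e)) →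
            GroupPres.QEquiv Q (CWMorse.standardPres T b') := by
  have hfin := CWMorse.finite_cells hdim
  have htree := hM.isSpanningTree_treeOf hreg hdim hcrit
  refine ⟨hreg.exists_isBoundaryWord, htree, fun b hb l hl =>
    ⟨hM.exists_isMorsePres hreg hb hl, fun Q hQ T hT b' hb' => ?_⟩⟩
  refine hQ.2.qEquiv.symm.trans (htree.qEquiv_standardPres hT
    (fun e => ((hb e).isSimpleCycle hreg).closed) fun e => ?_)
  exact ((hb e).isSimpleCycle hreg).isConj_or ((hb' e).isSimpleCycle hreg)
    ((hb e).mem_iff_mem (hb' e))
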